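/- Let $\beta>0$, let $\Gamma_\beta=\{e^{2k\pi\beta}:k\in\mathbb Z\}\subset\mathbb C^*$, let $\mathbb E=\mathbb C^*/\Gamma_\beta$ (an elliptic curve), and let $X=\mathbb P^1\times\mathbb E$ with $\mathbb P^1=\mathbb C\cup\{\infty\}$. Let $$\mathbb O=\{(z,[w])\in\mathbb P^1\times\mathbb E:\ z\in\mathbb C,\ \operatorname{Re}(zw)>0\}.$$ Let $\phi=\dfrac{dz}{1+|z|^2}$, let $\psi$ be the $(1,0)$-form on $\mathbb E$ whose pullback to $\mathbb C^*$ is $\dfrac{dw}{w}$, and equip $\mathbb O$ with the Hermitian metric $\phi\otimes\overline\phi+\psi\otimes\overline\psi$. Let $L^2_{p,q}(\mathbb O)$ be the space of square integrable $(p,q)$-forms on $\mathbb O$ with respect to this metric, and let $\overline\partial:L^2_{p,q}(\mathbb O)\dashrightarrow L^2_{p,q+1}(\mathbb O)$ be the weak maximal realization: its domain consists of all $f\in L^2_{p,q}(\mathbb O)$ for which $\overline\partial f$, taken in the sense of distributions, lies in $L^2_{p,q+1}(\mathbb O)$. Then the form $g=\overline\phi\wedge\phi\wedge\psi$ belongs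 to $L^2_{2,1}(\mathbb O)$, but it is not in the range of $\overline\partial:L^2_{2,0}(\mathbb O)\dashrightarrow L^2_{2,1}(\mathbb O)$. -/

import Mathlib

open scoped ContDiff

noncomputable section

namespace Ohsawa

/-! ### Exterior algebra and the operator `∂̄` on open subsets of `ℂ²` -/

/-- Complex valued alternating real `k`-covectors on `ℂ²`: the values of (complex valued)
differential forms of degree `k` at a point of an open subset of `ℂ²`. -/
abbrev Cov (k : ℕ) : Type := (ℂ × ℂ) [⋀^Fin k]→L[ℝ] ℂ

/-- The wedge product `θ ∧ α` of a `1`-covector and a `k`-covector,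
`(θ ∧ α)(v₀, …, v_k) = ∑ᵢ (-1)ⁱ θ(vᵢ) α(v₀, …, v̂ᵢ, …, v_k)`. -/
def wedge {k : ℕ} (θ : (ℂ × ℂ) →L[ℝ] ℂ) (α : Cov k) : Cov (k + 1) :=
  ContinuousAlternatingMap.alternatizeUncurryFin (θ.smulRight α)

/-- A `1`-covector seen as an alternating covector of degree `1`. -/
def oneCov (θ : (ℂ × ℂ) →L[ℝ] ℂ) : Cov 1 :=
  ContinuousAlternatingMap.ofSubsingleton ℝ (ℂ × ℂ) ℂ (0 : Fin 1) θ

/-- Complex conjugate of a `1`-covector. -/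
def conjCov (θ : (ℂ × ℂ) →L[ℝ] ℂ) : (ℂ × ℂ) →L[ℝ] ℂ :=
  (Complex.conjCLE : ℂ →L[ℝ] ℂ).comp θ

/-- A covector of degree `p + q` has bidegree `(p, q)`, i.e. it is a combination of the
`dζ_I ∧ dζ̄_J` with `|I| = p` and `|J| = q`, iff it satisfies
`α(ζ v₁, …, ζ v_k) = ζ ^ p * conj ζ ^ q * α(v₁, …, v_k)` for all `ζ ∈ ℂ`. -/
def HasBidegree (p q : ℕ) (α : Cov (p + q)) : Prop :=
  ∀ (ζ : ℂ) (v : Fin (p + q) → ℂ × ℂ),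
    α (fun i => ζ • v i) = ζ ^ p * (starRingEnd ℂ ζ) ^ q * α v

/-- `∂̄χ = ∑ⱼ (∂χ/∂ζ̄ⱼ) dζ̄ⱼ` for a function `χ` on `ℂ²`: the complex antilinear part
`v ↦ (dχ(v) + i dχ(iv)) / 2` of the differential. -/
def dbarFun (χ : ℂ × ℂ → ℂ) (x : ℂ × ℂ) : (ℂ × ℂ) →L[ℝ] ℂ :=
  (1 / 2 : ℂ) • (fderiv ℝ χ x +
    Complex.I • (fderiv ℝ χ x).comp
      ((Complex.I • ContinuousLinearMap.id ℂ (ℂ × ℂ)).restrictScalars ℝ))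

/-- `∂̄f = g` on the open set `U ⊆ ℂ²` in the sense of distributions. Both forms are locally
integrable, and `∫ χ g = - ∫ ∂̄χ ∧ f` for every test function `χ ∈ C_c^∞(U)`; the integrals are
taken coefficientwise with respect to the Lebesgue measure. -/
def IsWeakDbar {k : ℕ} (U : Set (ℂ × ℂ)) (f : ℂ × ℂ → Cov k) (g : ℂ × ℂ → Cov (k + 1)) : Prop :=
  MeasureTheory.LocallyIntegrableOn f U ∧ MeasureTheory.LocallyIntegrableOn g U ∧
    ∀ χ : ℂ × ℂ → ℂ, ContDiff ℝ ∞ χ → HasCompactSupport χ → tsupport χ ⊆ U →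
      ∫ x in U, χ x • g x = - ∫ x in U, wedge (dbarFun χ x) (f x)

/-! ### The elliptic curve, the ambient surface and the domain -/

/-- The number `e^{2πβ}` as an element of `ℂ*`. -/
def gen (β : ℝ) : ℂˣ := Units.mk0 (Real.exp (2 * Real.pi * β) : ℂ) (by
  exact_mod_cast (Real.exp_pos _).ne')

/-- The group `Γ_β = {e^{2kπβ} : k ∈ ℤ}`. -/
def Gam (β : ℝ) : Subgroup ℂˣ := Subgroup.zpowers (gen β)

/-- The elliptic curve `𝔼 = ℂ* / Γ_β`. -/
abbrev Ell (β : ℝ) : Type := ℂˣ ⧸ Gam β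

/-- The compact complex surface `X = ℙ¹ × 𝔼`, with `ℙ¹ = ℂ ∪ {∞}`. -/
abbrev Surf (β : ℝ) : Type := OnePoint ℂ × Ell β

/-- The map `(z, w) ↦ (z, [w])` from `ℂ × ℂ*` onto `(ℙ¹ ∖ {∞}) × 𝔼`. It is a covering map with deck
group `Γ_β`, and a local biholomorphism by definition of the complex structure of `𝔼`: the local
inverses of this map are the holomorphic coordinates `(z, w)` on `X`. -/
def proj (β : ℝ) (p : ℂ × ℂˣ) : Surf β := ((p.1 : OnePoint ℂ), (p.2 : Ell β))

/-- The domain `𝕆 = {(z, [w]) ∈ ℙ¹ × 𝔼 : Re (z w) > 0}`. -/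
def dom (β : ℝ) : Set (Surf β) :=
  {x | ∃ (z : ℂ) (w : ℂˣ), x = proj β (z, w) ∧ 0 < (z * (w : ℂ)).re}

/-- The open set of all `(z, w) ∈ ℂ × ℂ*` with `(z, [w]) ∈ 𝕆`, a covering of `𝕆`. -/
def cover (β : ℝ) : Set (ℂ × ℂ) :=
  {p | ∃ w : ℂˣ, (w : ℂ) = p.2 ∧ proj β (p.1, w) ∈ dom β}

/-- The condition `Re (z w) > 0` does not depend on the choice of the lift `w` of `[w]`. -/
theorem mem_dom_iff (β : ℝ) (z : ℂ) (w : ℂˣ) :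
    proj β (z, w) ∈ dom β ↔ 0 < (z * (w : ℂ)).re := by
  constructor
  · rintro ⟨z', w', h, hpos⟩
    obtain ⟨h1, h2⟩ := Prod.mk.inj h
    have hz : z = z' := OnePoint.coe_injective h1
    obtain ⟨n, hn⟩ := Subgroup.mem_zpowers_iff.mp (QuotientGroup.eq.mp h2)
    have hw : w' = w * gen β ^ n := by rw [hn]; group
    have hg : ((gen β ^ n : ℂˣ) : ℂ) = ((Real.exp (2 * Real.pi * β) ^ n : ℝ) : ℂ) := by
      simp [gen]
    rw [← hz, hw, Units.val_mul, hg, ← mul_assoc, Complex.re_mul_ofReal] at hpos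
    exact (mul_pos_iff_of_pos_right (zpow_pos (Real.exp_pos _) n)).mp hpos
  · exact fun h => ⟨z, w, rfl, h⟩

theorem cover_eq (β : ℝ) : cover β = {p : ℂ × ℂ | 0 < (p.1 * p.2).re} := by
  ext ⟨z, w⟩
  constructor
  · rintro ⟨u, hu, h⟩
    have := (mem_dom_iff β z u).mp h
    rwa [hu] at this
  · intro h
    have hw : w ≠ 0 := by
      rintro rfl
      simp at h
    exact ⟨Units.mk0 w hw, rfl, (mem_dom_iff β z _).mpr h⟩

/-! ### Differential forms on the domain -/

/-- The derivative `(a, b) ↦ (a, (w' / w) b)` of the map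
`(z, ζ) ↦ (z, (w' / w) ζ)`, which for `[w] = [w']` is the deck transformation that
takes `(z, w)` to `(z, w')`. -/
def deckDeriv (w w' : ℂˣ) : (ℂ × ℂ) →L[ℝ] (ℂ × ℂ) :=
  ((ContinuousLinearMap.fst ℂ ℂ ℂ).prod
    (((w' : ℂ) / (w : ℂ)) • ContinuousLinearMap.snd ℂ ℂ ℂ)).restrictScalars ℝ

/-- A complex valued differential form of degree `k` on `𝕆` (with no regularity), written in the
local holomorphic coordinates `(z, w)`: a form on the covering of `𝕆` whose values at two points
`(z, w)`, `(z, w')` over the same point `(z, [w]) = (z, [w'])` of `𝕆` correspond to each other under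
the change of coordinates (i.e. it is invariant under the deck group). -/
structure Form (β : ℝ) (k : ℕ) where
  /-- The coordinate expression; only its values on `cover β` matter. -/
  toFun : ℂ × ℂ → Cov k
  /-- Compatibility with the changes of coordinates. -/
  compat : ∀ (z : ℂ) (w w' : ℂˣ), (w : Ell β) = (w' : Ell β) → proj β (z, w) ∈ dom β →
    toFun (z, w) = (toFun (z, w')).compContinuousLinearMap (deckDeriv w w')

/-! ### The Hermitian metric `φ ⊗ φ̄ + ψ ⊗ ψ̄` and the spaces of square integrable forms -/

/-- The `(1,0)`-form `φ = dz / (1 + |z|²)`. -/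
def phi (p : ℂ × ℂ) : (ℂ × ℂ) →L[ℝ] ℂ :=
  ((1 + ‖p.1‖ ^ 2)⁻¹ : ℝ) • ContinuousLinearMap.fst ℝ ℂ ℂ

/-- The `(1,0)`-form `ψ` on `𝔼`, whose pullback to `ℂ*` is `dw / w`. -/
def psi (p : ℂ × ℂ) : (ℂ × ℂ) →L[ℝ] ℂ :=
  (p.2⁻¹ : ℂ) • ContinuousLinearMap.snd ℝ ℂ ℂ

/-- The vectors `E₁, iE₁, E₂, iE₂`, where `E₁ = ((1 + |z|²), 0)` and `E₂ = (0, w)` form the frame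
dual to `φ, ψ`. They are an orthonormal real basis for the Riemannian metric
`|φ|² + |ψ|²` at `(z, w)`. -/
def frame (p : ℂ × ℂ) : Fin 4 → ℂ × ℂ :=
  ![(((1 + ‖p.1‖ ^ 2 : ℝ) : ℂ), 0), (Complex.I * ((1 + ‖p.1‖ ^ 2 : ℝ) : ℂ), 0),
    (0, p.2), (0, Complex.I * p.2)]

/-- The square of the pointwise norm, at `(z, w)`, of a `k`-covector: the sum of `|α(e_I)|²` over the
increasing multi-indices `I`, normalized by `2⁻ᵏ` so that `φ, ψ, φ̄, ψ̄` and their wedge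
monomials have norm one. -/
def normSq {k : ℕ} (p : ℂ × ℂ) (α : Cov k) : ℝ :=
  (2 ^ k)⁻¹ * ∑ σ : Fin k ↪o Fin 4, ‖α (fun i => frame p (σ i))‖ ^ 2

/-- A fundamental domain for the action of `Γ_β` on the covering of `𝕆`: every point of `𝕆` is
`(z, [w])` for exactly one `(z, w)` in this set. -/
def fundDom (β : ℝ) : Set (ℂ × ℂ) :=
  {p | p ∈ cover β ∧ 1 ≤ ‖p.2‖ ∧ ‖p.2‖ < Real.exp (2 * Real.pi * β)}

/-- The density of the Riemannian volume form `(-2i)⁻² φ ∧ φ̄ ∧ ψ ∧ ψ̄` with respect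
to the Lebesgue measure in the coordinates `(z, w)`. -/
def volDensity (p : ℂ × ℂ) : ℝ := ((1 + ‖p.1‖ ^ 2) ^ 2 * ‖p.2‖ ^ 2)⁻¹

/-- `∫_𝕆 |f|² dV`. The integrand does not depend on the choice of the point of the covering over
a point of `𝕆`, and the integral is taken over a fundamental domain. -/
def sqNorm {β : ℝ} {k : ℕ} (f : Form β k) : ENNReal :=
  ∫⁻ p in fundDom β, ENNReal.ofReal (normSq p (f.toFun p) * volDensity p)

/-- `L²_{p,q}(𝕆)`: the measurable square integrable `(p, q)`-forms on `𝕆`. -/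
def L2 (β : ℝ) (p q : ℕ) : Set (Form β (p + q)) :=
  {f | (∀ x ∈ cover β, HasBidegree p q (f.toFun x)) ∧
    MeasureTheory.AEStronglyMeasurable f.toFun (MeasureTheory.volume.restrict (cover β)) ∧
    sqNorm f < ⊤}

/-- The graph of the weak maximal realization `∂̄ : L²_{p,q}(𝕆) ⇢ L²_{p,q+1}(𝕆)`: the pairs
`(f, g)` of square integrable forms with `∂̄f = g` in the sense of distributions. (This condition is
local on `𝕆`, so it can be tested in the coordinates `(z, w)` of the covering.) -/
def dbarGraph (β : ℝ) (p q : ℕ) : Set (Form β (p + q) × Form β (p + (q + 1))) :=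
  {fg | fg.1 ∈ L2 β p q ∧ fg.2 ∈ L2 β p (q + 1) ∧
    IsWeakDbar (cover β) fg.1.toFun fg.2.toFun}

/-- The range of `∂̄ : L²_{p,q}(𝕆) ⇢ L²_{p,q+1}(𝕆)`. -/
def dbarRange (β : ℝ) (p q : ℕ) : Set (Form β (p + (q + 1))) :=
  {g | ∃ f : Form β (p + q), (f, g) ∈ dbarGraph β p q}

theorem wedge_comp {k : ℕ} (θ : (ℂ × ℂ) →L[ℝ] ℂ) (α : Cov k) (A : (ℂ × ℂ) →L[ℝ] (ℂ × ℂ)) :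
    (wedge θ α).compContinuousLinearMap A
      = wedge (θ.comp A) (α.compContinuousLinearMap A) := by
  ext v
  simp only [wedge, ContinuousAlternatingMap.compContinuousLinearMap_apply,
    ContinuousAlternatingMap.alternatizeUncurryFin_apply]
  rfl

theorem phi_comp (z : ℂ) (w w' : ℂˣ) :
    (phi (z, (w' : ℂ))).comp (deckDeriv w w') = phi (z, (w : ℂ)) := by
  ext v <;> simp [phi, deckDeriv]

theorem psi_comp (z : ℂ) (w w' : ℂˣ) :
    (psi (z, (w' : ℂ))).comp (deckDeriv w w') = psi (z, (w : ℂ)) := by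
  ext v <;> simp [psi, deckDeriv]
  field_simp

/-- The `(2,1)`-form `g = φ̄ ∧ φ ∧ ψ` on `𝕆`. -/
def gForm (β : ℝ) : Form β 3 where
  toFun p := wedge (conjCov (phi p)) (wedge (phi p) (oneCov (psi p)))
  compat z w w' _ _ := by
    have h1 : (conjCov (phi (z, (w' : ℂ)))).comp (deckDeriv w w')
        = conjCov (phi (z, (w : ℂ))) := by
      rw [← phi_comp z w w']; rfl
    have h2 : (oneCov (psi (z, (w' : ℂ)))).compContinuousLinearMap (deckDeriv w w')
        = oneCov (psi (z, (w : ℂ))) := by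
      rw [← psi_comp z w w']; rfl
    rw [wedge_comp, wedge_comp, h1, h2, phi_comp]

end Ohsawa

end

open scoped ContDiff

noncomputable section

namespace Ohsawa

open MeasureTheory Filter Topology

/-! ### Covectors of bidegree `(2, 0)` and wedge products in coordinates -/

/-! Membership of `g` in L² is direct. In the frame dual to `φ, ψ` its coefficients are bounded, and
the volume over a fundamental domain is finite because `(1 + |z|²)⁻²` is integrable on ℂ.

For the second claim, suppose `∂̄f = g` with `f = h dz ∧ dw`. Then, weakly, `∂h/∂z̄ = (1 + |z|²)⁻²
w⁻¹` and `∂h/∂w̄ = 0`. The field `V = z̄ ∂_z̄ - w̄ ∂_w̄` is tangent to the curves `zw = ξ`, so `u =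
zw h` satisfies `V u = |z|² / (1 + |z|²)²`. On such a curve, a copy of ℂ* with coordinate `z`, `V`
is `z̄ ∂_z̄`. Writing `t = |z|²`, the mean of `u` over `arg z` is therefore `t / (1 + t)` plus a
constant, and it gains exactly 1 between `z = 0` and `z = ∞`.

Square integrability forbids this jump. Put `L = e^{2πβ}`. The L² norm of `f` controls `∫ |h|²` over
the fundamental domain, so the integrals over the disjoint shells `|z| ~ L^k` tend to 0 as `k → ±∞`.
Deck invariance gives `|h(z, L^{-k} w)| = L^k |h(z, w)|`. The measure-preserving map `(z, w) ↦ (L^k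
z, L^{-k} w)`, which fixes `zw`, then shows that `u` tends to 0 in L² at both ends.

The proof tests the equation against `σ(|z|²) zw b(zw)`, where `b` is a bump and `σ` a plateau on
`[q⁻¹, q]`, with `q = L^{2n}`. The side of `g` stays above a positive constant
(`exists_pos_le_integral_plateau`). The side of `f` (`IsWeakDbar.radial_bump`) lives on the two
shells where `σ` varies and tends to 0 (`lintegral_radial_le`, `tendsto_lintegral_shell`). -/

theorem wedge_apply_two (θ : (ℂ × ℂ) →L[ℝ] ℂ) (α : Cov 1) (v : Fin 2 → ℂ × ℂ) :
    wedge θ α v = θ (v 0) * α ![v 1] - θ (v 1) * α ![v 0] := by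
  have h0 : Fin.removeNth 0 v = ![v 1] := by ext i : 1; fin_cases i; rfl
  have h1 : Fin.removeNth 1 v = ![v 0] := by ext i : 1; fin_cases i; rfl
  simp [wedge, ContinuousAlternatingMap.alternatizeUncurryFin_apply, Fin.sum_univ_two, h0, h1,
    sub_eq_add_neg]

theorem wedge_apply_three (θ : (ℂ × ℂ) →L[ℝ] ℂ) (α : Cov 2) (v : Fin 3 → ℂ × ℂ) :
    wedge θ α v = θ (v 0) * α ![v 1, v 2] - θ (v 1) * α ![v 0, v 2]
      + θ (v 2) * α ![v 0, v 1] := by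
  have h0 : Fin.removeNth 0 v = ![v 1, v 2] := by ext i : 1; fin_cases i <;> rfl
  have h1 : Fin.removeNth 1 v = ![v 0, v 2] := by ext i : 1; fin_cases i <;> rfl
  have h2 : Fin.removeNth 2 v = ![v 0, v 1] := by ext i : 1; fin_cases i <;> rfl
  simp [wedge, ContinuousAlternatingMap.alternatizeUncurryFin_apply, Fin.sum_univ_three, h0, h1,
    h2, sub_eq_add_neg]

theorem oneCov_apply (θ : (ℂ × ℂ) →L[ℝ] ℂ) (v : Fin 1 → ℂ × ℂ) : oneCov θ v = θ (v 0) := rfl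

/-- The `(2,0)`-covector `dz ∧ dw`. -/
def dzdw : Cov 2 :=
  wedge (ContinuousLinearMap.fst ℝ ℂ ℂ) (oneCov (ContinuousLinearMap.snd ℝ ℂ ℂ))

theorem dzdw_apply (v : Fin 2 → ℂ × ℂ) :
    dzdw v = (v 0).1 * (v 1).2 - (v 1).1 * (v 0).2 := by
  simp [dzdw, wedge_apply_two, oneCov_apply]

theorem cov_two_add_left (α : Cov 2) (u u' v : ℂ × ℂ) :
    α ![u + u', v] = α ![u, v] + α ![u', v] := by
  have h := α.map_update_add ![u, v] 0 u u'
  simp only [Matrix.vecCons, Fin.update_cons_zero] at h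
  exact h

theorem cov_two_swap (α : Cov 2) (u v : ℂ × ℂ) : α ![u, v] = -α ![v, u] := by
  have h := α.toAlternatingMap.map_swap ![v, u] (show (0 : Fin 2) ≠ 1 by decide)
  have e : (![v, u] ∘ Equiv.swap (0 : Fin 2) 1) = ![u, v] := by
    ext i : 1; fin_cases i <;> simp
  rw [e] at h
  exact h

theorem cov_two_add_right (α : Cov 2) (u v v' : ℂ × ℂ) :
    α ![u, v + v'] = α ![u, v] + α ![u, v'] := by
  rw [cov_two_swap, cov_two_add_left, cov_two_swap α u v, cov_two_swap α u v']; ring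

theorem cov_two_real_smul_left (α : Cov 2) (c : ℝ) (u v : ℂ × ℂ) :
    α ![c • u, v] = c * α ![u, v] := by
  have h := α.map_update_smul ![u, v] 0 c u
  simp only [Matrix.vecCons, Fin.update_cons_zero] at h
  exact h

theorem HasBidegree.smul_both {α : Cov 2} (h : HasBidegree 2 0 α) (ζ : ℂ) (u v : ℂ × ℂ) :
    α ![ζ • u, ζ • v] = ζ ^ 2 * α ![u, v] := by
  have := h ζ ![u, v]
  have e : (fun i => ζ • (![u, v] : Fin 2 → ℂ × ℂ) i) = ![ζ • u, ζ • v] := by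
    ext i : 1; fin_cases i <;> rfl
  simp only [Nat.add_zero] at this
  rw [e] at this
  simpa using this

/-- Polarization: the bidegree condition at `1 + i` and at `i` gives `α(iu, v) + α(u, iv) = 2i α(u,
v)`. Replacing `v` by `iv` then isolates `α(u, iv)`. -/
theorem HasBidegree.I_smul_right {α : Cov 2} (h : HasBidegree 2 0 α) (u v : ℂ × ℂ) :
    α ![u, Complex.I • v] = Complex.I * α ![u, v] := by
  have key : ∀ u v : ℂ × ℂ, α ![Complex.I • u, v] + α ![u, Complex.I • v]
      = 2 * Complex.I * α ![u, v] := by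
    intro u v
    have h1 := h.smul_both (1 + Complex.I) u v
    have h2 := h.smul_both Complex.I u v
    simp only [add_smul, one_smul, cov_two_add_left, cov_two_add_right, h2] at h1
    linear_combination h1
  have h3 := key u (Complex.I • v)
  have h2 := h.smul_both Complex.I u v
  have h4 : α ![u, Complex.I • Complex.I • v] = - α ![u, v] := by
    rw [smul_smul, Complex.I_mul_I, cov_two_swap, cov_two_swap α u v]
    have := cov_two_real_smul_left α (-1) v u
    simp only [neg_smul, one_smul] at this ⊢
    rw [this]; simp
  rw [h2, h4, Complex.I_sq] at h3
  linear_combination (Complex.I / 2) * h3 + α ![u, Complex.I • v] * Complex.I_sq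

theorem HasBidegree.smul_right {α : Cov 2} (h : HasBidegree 2 0 α) (c : ℂ) (u v : ℂ × ℂ) :
    α ![u, c • v] = c * α ![u, v] := by
  have e : c • v = (c.re : ℝ) • v + (c.im : ℝ) • (Complex.I • v) := by
    conv_lhs => rw [← Complex.re_add_im c]
    rw [add_smul, mul_smul]
    rfl
  rw [e, cov_two_add_right, cov_two_swap, cov_two_real_smul_left, cov_two_swap α u (_ • _),
    cov_two_real_smul_left, cov_two_swap α v, cov_two_swap α (Complex.I • v), h.I_smul_right]
  conv_rhs => rw [← Complex.re_add_im c]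
  ring

theorem HasBidegree.smul_left {α : Cov 2} (h : HasBidegree 2 0 α) (c : ℂ) (u v : ℂ × ℂ) :
    α ![c • u, v] = c * α ![u, v] := by
  rw [cov_two_swap, h.smul_right, cov_two_swap α u]; ring

/-- The coefficient of `dz ∧ dw` in a covector of degree `2`. -/
def coeff (α : Cov 2) : ℂ := α ![(1, 0), (0, 1)]

theorem HasBidegree.eq_smul_dzdw {α : Cov 2} (h : HasBidegree 2 0 α) :
    α = coeff α • dzdw := by
  have self : ∀ u, α ![u, u] = 0 := fun u => by
    have := cov_two_swap α u u
    linear_combination this / 2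
  have dec : ∀ p : ℂ × ℂ, p = p.1 • ((1, 0) : ℂ × ℂ) + p.2 • ((0, 1) : ℂ × ℂ) := by
    intro p; ext <;> simp
  ext v
  have ev : v = ![v 0, v 1] := by ext i : 1; fin_cases i <;> rfl
  rw [ContinuousAlternatingMap.smul_apply, dzdw_apply, smul_eq_mul, coeff]
  conv_lhs => rw [ev, dec (v 0), dec (v 1)]
  simp only [cov_two_add_left, cov_two_add_right, h.smul_left, h.smul_right, self]
  rw [cov_two_swap α (0, 1) (1, 0)]
  ring

/-- The covector `dz̄`. -/
def dzbar : (ℂ × ℂ) →L[ℝ] ℂ := conjCov (ContinuousLinearMap.fst ℝ ℂ ℂ)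

/-- The covector `dw̄`. -/
def dwbar : (ℂ × ℂ) →L[ℝ] ℂ := conjCov (ContinuousLinearMap.snd ℝ ℂ ℂ)

theorem wedge_smul_right {k : ℕ} (θ : (ℂ × ℂ) →L[ℝ] ℂ) (c : ℂ) (α : Cov k) :
    wedge θ (c • α) = c • wedge θ α := by
  ext v
  simp only [wedge, ContinuousAlternatingMap.alternatizeUncurryFin_apply,
    ContinuousAlternatingMap.smul_apply, ContinuousLinearMap.smulRight_apply, smul_eq_mul,
    zsmul_eq_mul, Finset.mul_sum]
  exact Finset.sum_congr rfl fun i _ => by ring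

theorem wedge_smul_left {k : ℕ} (θ : (ℂ × ℂ) →L[ℝ] ℂ) (c : ℂ) (α : Cov k) :
    wedge (c • θ) α = c • wedge θ α := by
  ext v
  simp only [wedge, ContinuousAlternatingMap.alternatizeUncurryFin_apply,
    ContinuousAlternatingMap.smul_apply, ContinuousLinearMap.smulRight_apply, smul_eq_mul,
    zsmul_eq_mul, smul_apply, Finset.mul_sum]
  exact Finset.sum_congr rfl fun i _ => by ring

theorem wedge_add_left {k : ℕ} (θ θ' : (ℂ × ℂ) →L[ℝ] ℂ) (α : Cov k) :
    wedge (θ + θ') α = wedge θ α + wedge θ' α := by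
  ext v
  simp only [wedge, ContinuousAlternatingMap.alternatizeUncurryFin_apply,
    ContinuousAlternatingMap.add_apply, ContinuousLinearMap.smulRight_apply]
  rw [← Finset.sum_add_distrib]
  exact Finset.sum_congr rfl fun i _ => by simp; ring

/-- The two coordinates of an antilinear covector with respect to `dz̄, dw̄`. -/
theorem eq_dzbar_add_dwbar {θ : (ℂ × ℂ) →L[ℝ] ℂ}
    (h : ∀ v, θ (Complex.I • v) = -Complex.I * θ v) :
    θ = θ (1, 0) • dzbar + θ (0, 1) • dwbar := by
  have hs : ∀ (c : ℂ) (v : ℂ × ℂ), θ (c • v) = (starRingEnd ℂ c) * θ v := by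
    intro c v
    have e : c • v = (c.re : ℝ) • v + (c.im : ℝ) • (Complex.I • v) := by
      conv_lhs => rw [← Complex.re_add_im c]
      rw [add_smul, mul_smul]
      rfl
    have hc : starRingEnd ℂ c = c.re - c.im * Complex.I := by
      apply Complex.ext <;> simp
    rw [e, map_add, map_smul, map_smul, h, hc, Complex.real_smul, Complex.real_smul]
    ring
  refine ContinuousLinearMap.ext fun p => ?_
  have dec : p = p.1 • ((1, 0) : ℂ × ℂ) + p.2 • ((0, 1) : ℂ × ℂ) := by ext <;> simp
  conv_lhs => rw [dec, map_add, hs, hs]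
  simp [dzbar, dwbar, conjCov]
  ring

theorem dbarFun_I_smul (χ : ℂ × ℂ → ℂ) (x v : ℂ × ℂ) :
    dbarFun χ x (Complex.I • v) = -Complex.I * dbarFun χ x v := by
  have e : Complex.I • Complex.I • v = -v := by
    rw [smul_smul, Complex.I_mul_I, neg_smul, one_smul]
  simp only [dbarFun, smul_apply, add_apply,
    ContinuousLinearMap.comp_apply, ContinuousLinearMap.coe_restrictScalars',
    ContinuousLinearMap.id_apply, smul_eq_mul, e, map_neg]
  linear_combination (1 / 2 : ℂ) * (fderiv ℝ χ x (Complex.I • v)) * Complex.I_sq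

theorem gForm_toFun (β : ℝ) (p : ℂ × ℂ) :
    (gForm β).toFun p
      = ((((1 + ‖p.1‖ ^ 2) ^ 2)⁻¹ : ℝ) * p.2⁻¹ : ℂ) • wedge dzbar dzdw := by
  change wedge (conjCov (phi p)) (wedge (phi p) (oneCov (psi p))) = _
  have h1 : phi p = (((1 + ‖p.1‖ ^ 2)⁻¹ : ℝ) : ℂ) • ContinuousLinearMap.fst ℝ ℂ ℂ := rfl
  have h2 : conjCov (phi p) = (((1 + ‖p.1‖ ^ 2)⁻¹ : ℝ) : ℂ) • dzbar := by
    refine ContinuousLinearMap.ext fun v => ?_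
    simp [phi, conjCov, dzbar]
  have h3 : oneCov (psi p) = p.2⁻¹ • oneCov (ContinuousLinearMap.snd ℝ ℂ ℂ) := rfl
  rw [h2, h1, h3, wedge_smul_left, wedge_smul_right, wedge_smul_left, wedge_smul_right,
    wedge_smul_right, smul_smul, smul_smul, dzdw]
  congr 1
  push_cast
  rw [← inv_pow]
  ring

/-! ### Square integrability of `g` -/

theorem dzbar_apply (v : ℂ × ℂ) : dzbar v = starRingEnd ℂ v.1 := rfl

theorem dwbar_apply (v : ℂ × ℂ) : dwbar v = starRingEnd ℂ v.2 := rfl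

theorem hasBidegree_gForm (β : ℝ) (p : ℂ × ℂ) : HasBidegree 2 1 ((gForm β).toFun p) := by
  intro ζ v
  change (gForm β).toFun p (fun i : Fin 3 => ζ • v i) = _ * (gForm β).toFun p v
  rw [gForm_toFun]
  simp only [ContinuousAlternatingMap.smul_apply, wedge_apply_three, dzdw_apply, dzbar_apply,
    smul_eq_mul, Prod.smul_fst, Prod.smul_snd, map_mul, Matrix.cons_val_zero, Matrix.cons_val_one]
  ring

theorem snd_ne_zero_of_mem_cover {β : ℝ} {p : ℂ × ℂ} (h : p ∈ cover β) : p.2 ≠ 0 := by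
  obtain ⟨w, hw, -⟩ := h
  exact hw ▸ w.ne_zero

theorem isOpen_cover (β : ℝ) : IsOpen (cover β) := by
  rw [cover_eq]
  exact isOpen_lt continuous_const (by fun_prop)

theorem aestronglyMeasurable_gForm (β : ℝ) (μ : Measure (ℂ × ℂ)) :
    AEStronglyMeasurable (gForm β).toFun μ := by
  have e : (gForm β).toFun = fun p : ℂ × ℂ =>
      ((((1 + ‖p.1‖ ^ 2) ^ 2)⁻¹ : ℝ) * p.2⁻¹ : ℂ) • wedge dzbar dzdw :=
    funext (gForm_toFun β)
  rw [e]
  have hm : Measurable fun p : ℂ × ℂ => ((((1 + ‖p.1‖ ^ 2) ^ 2)⁻¹ : ℝ) * p.2⁻¹ : ℂ) := by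
    fun_prop
  exact hm.aestronglyMeasurable.smul_const _

theorem norm_wedge_dzbar_dzdw_le {v : Fin 3 → ℂ × ℂ} {a b : ℝ}
    (h1 : ∀ i, ‖(v i).1‖ ≤ a) (h2 : ∀ i, ‖(v i).2‖ ≤ b) :
    ‖wedge dzbar dzdw v‖ ≤ 6 * (a ^ 2 * b) := by
  have ha : 0 ≤ a := (norm_nonneg _).trans (h1 0)
  have hd : ∀ i j, ‖dzdw ![v i, v j]‖ ≤ 2 * (a * b) := by
    intro i j
    rw [dzdw_apply]
    refine (norm_sub_le _ _).trans ?_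
    simp only [norm_mul, Matrix.cons_val_zero, Matrix.cons_val_one]
    have e1 := mul_le_mul (h1 i) (h2 j) (norm_nonneg _) ha
    have e2 := mul_le_mul (h1 j) (h2 i) (norm_nonneg _) ha
    linarith
  have ht : ∀ i j k, ‖dzbar (v i) * dzdw ![v j, v k]‖ ≤ 2 * (a ^ 2 * b) := by
    intro i j k
    rw [norm_mul, dzbar_apply, RCLike.norm_conj]
    calc _ ≤ a * (2 * (a * b)) := mul_le_mul (h1 i) (hd j k) (norm_nonneg _) ha
      _ = _ := by ring
  rw [wedge_apply_three]
  refine (norm_add_le _ _).trans ?_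
  have := norm_sub_le (dzbar (v 0) * dzdw ![v 1, v 2]) (dzbar (v 1) * dzdw ![v 0, v 2])
  linarith [ht 0 1 2, ht 1 0 2, ht 2 0 1]

/-- The frame vectors have components of size at most `1 + |z|²` and `|w|`, which cancel the
coefficient of `g`. The 6 counts the terms of the expanded triple wedge. -/
theorem norm_gForm_frame_le (β : ℝ) {p : ℂ × ℂ} (hp : p.2 ≠ 0) (s : Fin 3 → Fin 4) :
    ‖(gForm β).toFun p (fun i => frame p (s i))‖ ≤ 6 := by
  have h0 : (0 : ℝ) < 1 + ‖p.1‖ ^ 2 := by positivity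
  have hn : ‖(((1 + ‖p.1‖ ^ 2 : ℝ)) : ℂ)‖ = 1 + ‖p.1‖ ^ 2 := by
    rw [Complex.norm_real, Real.norm_of_nonneg h0.le]
  have h1 : ∀ j, ‖(frame p j).1‖ ≤ 1 + ‖p.1‖ ^ 2 := by
    intro j
    fin_cases j
    · exact hn.le
    · change ‖Complex.I * _‖ ≤ _
      rw [norm_mul, Complex.norm_I, one_mul, hn]
    · simpa [frame] using h0.le
    · simpa [frame] using h0.le
  have h2 : ∀ j, ‖(frame p j).2‖ ≤ ‖p.2‖ := by
    intro j
    fin_cases j <;> simp [frame]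
  rw [gForm_toFun, ContinuousAlternatingMap.smul_apply, norm_smul]
  have hw : 0 < ‖p.2‖ := norm_pos_iff.mpr hp
  have h3 := norm_wedge_dzbar_dzdw_le (v := fun i => frame p (s i))
    (fun i => h1 (s i)) (fun i => h2 (s i))
  rw [norm_mul, norm_inv, Complex.norm_real, Real.norm_of_nonneg (by positivity)]
  calc _ ≤ ((1 + ‖p.1‖ ^ 2) ^ 2)⁻¹ * ‖p.2‖⁻¹ * (6 * ((1 + ‖p.1‖ ^ 2) ^ 2 * ‖p.2‖)) := by gcongr
    _ = 6 := by field_simp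

theorem normSq_gForm_le (β : ℝ) {p : ℂ × ℂ} (hp : p.2 ≠ 0) :
    normSq p ((gForm β).toFun p) ≤ 36 * Fintype.card (Fin 3 ↪o Fin 4) := by
  have : ∑ σ : Fin 3 ↪o Fin 4, ‖(gForm β).toFun p (fun i => frame p (σ i))‖ ^ 2
      ≤ 36 * Fintype.card (Fin 3 ↪o Fin 4) := by
    calc _ ≤ ∑ _σ : Fin 3 ↪o Fin 4, (36 : ℝ) := by
          refine Finset.sum_le_sum fun σ _ => ?_
          have := norm_gForm_frame_le β hp σ
          nlinarith [norm_nonneg ((gForm β).toFun p (fun i => frame p (σ i)))]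
      _ = _ := by simp [mul_comm]
  have h0 : 0 ≤ ∑ σ : Fin 3 ↪o Fin 4, ‖(gForm β).toFun p (fun i => frame p (σ i))‖ ^ 2 := by
    positivity
  unfold normSq
  norm_num at this h0 ⊢
  linarith

theorem measurableSet_fundDom (β : ℝ) : MeasurableSet (fundDom β) := by
  have h1 : MeasurableSet {p : ℂ × ℂ | 1 ≤ ‖p.2‖} :=
    measurableSet_le measurable_const measurable_snd.norm
  have h2 : MeasurableSet {p : ℂ × ℂ | ‖p.2‖ < Real.exp (2 * Real.pi * β)} :=
    measurableSet_lt measurable_snd.norm measurable_const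
  exact (isOpen_cover β).measurableSet.inter (h1.inter h2)

theorem lintegral_volDensity_fundDom_lt_top (β : ℝ) :
    ∫⁻ p in fundDom β, ENNReal.ofReal (volDensity p) < ⊤ := by
  set A : Set ℂ := Metric.closedBall 0 (Real.exp (2 * Real.pi * β)) with hA
  have hsub : fundDom β ⊆ Set.univ ×ˢ A := fun p hp => by
    simpa [hA] using hp.2.2.le
  -- The exponent 4 exceeds the real dimension 2 of ℂ.
  have hfin : ∫⁻ z : ℂ, ENNReal.ofReal ((1 + ‖z‖ ^ 2) ^ (-(4 : ℝ) / 2)) < ⊤ := by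
    have h := integrable_rpow_neg_one_add_norm_sq (E := ℂ) (μ := volume) (r := 4)
      (by rw [Complex.finrank_real_complex]; norm_num)
    refine lt_of_le_of_lt ?_ h.2
    exact lintegral_mono fun z => Real.ofReal_le_enorm _
  calc ∫⁻ p in fundDom β, ENNReal.ofReal (volDensity p)
      ≤ ∫⁻ p in fundDom β, ENNReal.ofReal ((1 + ‖p.1‖ ^ 2) ^ (-(4 : ℝ) / 2)) * 1 := by
        refine setLIntegral_mono' (measurableSet_fundDom β) fun p hp => ?_
        rw [mul_one]
        refine ENNReal.ofReal_le_ofReal ?_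
        have e : ((1 + ‖p.1‖ ^ 2) ^ (-(4 : ℝ) / 2) : ℝ) = ((1 + ‖p.1‖ ^ 2) ^ 2)⁻¹ := by
          rw [show -(4 : ℝ) / 2 = -(2 : ℕ) by norm_num, Real.rpow_neg (by positivity),
            Real.rpow_natCast]
        rw [e, volDensity]
        have h1 : (1 : ℝ) ≤ ‖p.2‖ ^ 2 := one_le_pow₀ hp.2.1
        exact inv_anti₀ (by positivity) (le_mul_of_one_le_right (by positivity) h1)
    _ ≤ ∫⁻ p in Set.univ ×ˢ A, ENNReal.ofReal ((1 + ‖p.1‖ ^ 2) ^ (-(4 : ℝ) / 2)) * 1 :=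
        lintegral_mono_set hsub
    _ = (∫⁻ z : ℂ, ENNReal.ofReal ((1 + ‖z‖ ^ 2) ^ (-(4 : ℝ) / 2))) * ∫⁻ _ in A, 1 := by
        rw [Measure.volume_eq_prod, ← Measure.prod_restrict, Measure.restrict_univ,
          lintegral_prod_mul (f := fun z : ℂ => ENNReal.ofReal ((1 + ‖z‖ ^ 2) ^ (-(4 : ℝ) / 2)))
            (g := fun _ => 1) (by fun_prop) (by fun_prop)]
    _ < ⊤ := by
        refine ENNReal.mul_lt_top hfin ?_
        rw [setLIntegral_one]
        exact measure_closedBall_lt_top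

theorem gForm_mem_L2 (β : ℝ) : gForm β ∈ L2 β 2 1 := by
  refine ⟨fun p _ => hasBidegree_gForm β p, aestronglyMeasurable_gForm β _, ?_⟩
  set C : ℝ := 36 * Fintype.card (Fin 3 ↪o Fin 4) with hC
  have hC0 : 0 ≤ C := by positivity
  change ∫⁻ p in fundDom β, ENNReal.ofReal (normSq p ((gForm β).toFun p) * volDensity p) < ⊤
  calc _ ≤ ∫⁻ p in fundDom β, ENNReal.ofReal C * ENNReal.ofReal (volDensity p) := by
        refine setLIntegral_mono' (measurableSet_fundDom β) fun p hp => ?_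
        rw [← ENNReal.ofReal_mul hC0]
        refine ENNReal.ofReal_le_ofReal (mul_le_mul_of_nonneg_right ?_ ?_)
        · exact normSq_gForm_le β (snd_ne_zero_of_mem_cover hp.1)
        · unfold volDensity; positivity
    _ = ENNReal.ofReal C * ∫⁻ p in fundDom β, ENNReal.ofReal (volDensity p) :=
        lintegral_const_mul' _ _ ENNReal.ofReal_ne_top
    _ < ⊤ := ENNReal.mul_lt_top ENNReal.ofReal_lt_top (lintegral_volDensity_fundDom_lt_top β)

/-! ### The coefficient of a square integrable `(2, 0)`-form -/

/-- The `L²` norm controls the coefficient of `dz ∧ dw`. -/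
theorem normSq_mul_volDensity_ge {α : Cov 2} (h : HasBidegree 2 0 α) {p : ℂ × ℂ} (hp : p.2 ≠ 0) :
    ‖coeff α‖ ^ 2 / 4 ≤ normSq p α * volDensity p := by
  have hw : 0 < ‖p.2‖ := norm_pos_iff.mpr hp
  -- The indices 0 and 2 select `E₁, E₂`. On this pair `α` has modulus `(1 + |z|²) |w| |coeff α|`,
  -- whose weight is cancelled by the volume density. The remaining 1/4 is the normalization `2⁻²`.
  let σ : Fin 2 ↪o Fin 4 := OrderEmbedding.ofStrictMono ![0, 2] (by decide)
  have hσ : ‖α (fun i => frame p (σ i))‖ = (1 + ‖p.1‖ ^ 2) * ‖p.2‖ * ‖coeff α‖ := by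
    have e : (fun i => frame p (σ i)) = ![(((1 + ‖p.1‖ ^ 2 : ℝ) : ℂ)) • ((1, 0) : ℂ × ℂ),
        p.2 • ((0, 1) : ℂ × ℂ)] := by
      ext i : 1
      fin_cases i
      · ext <;> simp [frame, σ]
      · ext <;> simp [frame, σ]
    rw [e, h.smul_left, h.smul_right, ← mul_assoc, norm_mul, norm_mul, Complex.norm_real,
      Real.norm_of_nonneg (by positivity)]
    rfl
  have hle : ‖α (fun i => frame p (σ i))‖ ^ 2
      ≤ ∑ τ : Fin 2 ↪o Fin 4, ‖α (fun i => frame p (τ i))‖ ^ 2 :=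
    Finset.single_le_sum (f := fun τ : Fin 2 ↪o Fin 4 => ‖α (fun i => frame p (τ i))‖ ^ 2)
      (fun _ _ => by positivity) (Finset.mem_univ σ)
  rw [hσ] at hle
  unfold normSq volDensity
  rw [← div_eq_mul_inv, le_div_iff₀ (by positivity)]
  norm_num
  nlinarith

theorem lintegral_coeff_lt_top {β : ℝ} {f : Form β 2} (hf : f ∈ L2 β 2 0) :
    ∫⁻ p in fundDom β, ENNReal.ofReal (‖coeff (f.toFun p)‖ ^ 2) < ⊤ := by
  obtain ⟨hb, -, hs⟩ := hf
  calc _ ≤ ∫⁻ p in fundDom β,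
        4 * ENNReal.ofReal (normSq p (f.toFun p) * volDensity p) := by
        refine setLIntegral_mono' (measurableSet_fundDom β) fun p hp => ?_
        have h := normSq_mul_volDensity_ge (hb p hp.1) (snd_ne_zero_of_mem_cover hp.1)
        rw [show (4 : ENNReal) = ENNReal.ofReal 4 by norm_num, ← ENNReal.ofReal_mul (by norm_num)]
        exact ENNReal.ofReal_le_ofReal (by linarith)
    _ = 4 * ∫⁻ p in fundDom β, ENNReal.ofReal (normSq p (f.toFun p) * volDensity p) :=
        lintegral_const_mul' _ _ (by norm_num)
    _ < ⊤ := ENNReal.mul_lt_top (by norm_num) hs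

/-- Invariance of the coefficient of a `(2,0)`-form under the deck group. -/
theorem coeff_deck {β : ℝ} {f : Form β 2} (hf : ∀ x ∈ cover β, HasBidegree 2 0 (f.toFun x))
    {z w : ℂ} (hzw : (z, w) ∈ cover β) (k : ℤ) :
    coeff (f.toFun (z, w)) = (Real.exp (2 * Real.pi * β) : ℂ) ^ k *
      coeff (f.toFun (z, (Real.exp (2 * Real.pi * β) : ℂ) ^ k * w)) := by
  obtain ⟨u, rfl, hu⟩ := hzw
  set u' : ℂˣ := gen β ^ k * u with hu'
  have hval : (u' : ℂ) = (Real.exp (2 * Real.pi * β) : ℂ) ^ k * (u : ℂ) := by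
    simp [hu', gen]
  have hq : (u : Ell β) = (u' : Ell β) := by
    rw [QuotientGroup.eq, Gam, Subgroup.mem_zpowers_iff]
    exact ⟨k, by rw [hu', mul_comm u⁻¹, mul_inv_cancel_right]⟩
  have hmem : (z, (u' : ℂ)) ∈ cover β := by
    refine ⟨u', rfl, ?_⟩
    have : proj β (z, u') = proj β (z, u) := by simp [proj, hq]
    rwa [this]
  have hdiv : (u' : ℂ) / (u : ℂ) = (Real.exp (2 * Real.pi * β) : ℂ) ^ k := by
    rw [hval, mul_div_cancel_right₀ _ u.ne_zero]
  rw [← hval]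
  conv_lhs => rw [coeff, f.compat z u u' hq hu]
  rw [ContinuousAlternatingMap.compContinuousLinearMap_apply]
  have e : (deckDeriv u u' ∘ ![((1 : ℂ), (0 : ℂ)), (0, 1)])
      = ![(1, 0), ((Real.exp (2 * Real.pi * β) : ℂ) ^ k) • ((0, 1) : ℂ × ℂ)] := by
    ext i : 1
    fin_cases i
    · ext <;> simp [deckDeriv]
    · rw [← hdiv]
      ext <;> simp [deckDeriv]
  rw [e, (hf _ hmem).smul_right, coeff]

/-! ### The scalar equations contained in `∂̄f = g` -/

theorem dbarFun_eq (χ : ℂ × ℂ → ℂ) (x v : ℂ × ℂ) :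
    dbarFun χ x v = 1 / 2 * (fderiv ℝ χ x v + Complex.I * fderiv ℝ χ x (Complex.I • v)) := rfl

theorem continuous_dbarFun {χ : ℂ × ℂ → ℂ} (hχ : ContDiff ℝ ∞ χ) (v : ℂ × ℂ) :
    Continuous fun x => dbarFun χ x v := by
  have h := hχ.continuous_fderiv (by simp)
  simp only [dbarFun_eq]
  fun_prop

theorem support_dbarFun_subset (χ : ℂ × ℂ → ℂ) (v : ℂ × ℂ) :
    Function.support (fun x => dbarFun χ x v) ⊆ tsupport χ := by
  intro x hx
  by_contra h
  apply hx
  have : fderiv ℝ χ x = 0 := by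
    by_contra h'
    exact h (support_fderiv_subset ℝ h')
  simp [dbarFun_eq, this]

theorem integrableOn_mul_of_support_subset {g h : ℂ × ℂ → ℂ} {U K : Set (ℂ × ℂ)}
    (hh : LocallyIntegrableOn h U) (hg : Continuous g) (hK : IsCompact K) (hKU : K ⊆ U)
    (hs : Function.support g ⊆ K) : IntegrableOn (fun x => g x * h x) U := by
  have h1 : IntegrableOn (fun x => g x * h x) K :=
    (hh.integrableOn_compact_subset hKU hK).continuousOn_mul hg.continuousOn hK
  have h2 : Integrable (fun x => g x * h x) :=
    (integrableOn_iff_integrable_of_support_subset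
      ((Function.support_mul_subset_left _ _).trans hs)).mp h1
  exact h2.integrableOn

theorem locallyIntegrableOn_coeff {f : ℂ × ℂ → Cov 2} {U : Set (ℂ × ℂ)}
    (hf : LocallyIntegrableOn f U) : LocallyIntegrableOn (fun x => coeff (f x)) U := by
  intro x hx
  obtain ⟨s, hs, hi⟩ := hf x hx
  refine ⟨s, hs, ?_⟩
  exact (ContinuousAlternatingMap.apply ℝ (ℂ × ℂ) ℂ
    ![((1 : ℂ), (0 : ℂ)), (0, 1)]).integrable_comp hi

theorem wedge_dbarFun_eq {α : Cov 2} (h : HasBidegree 2 0 α) (χ : ℂ × ℂ → ℂ) (x : ℂ × ℂ) :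
    wedge (dbarFun χ x) α = (dbarFun χ x (1, 0) * coeff α) • wedge dzbar dzdw
      + (dbarFun χ x (0, 1) * coeff α) • wedge dwbar dzdw := by
  conv_lhs => rw [eq_dzbar_add_dwbar (dbarFun_I_smul χ x), h.eq_smul_dzdw]
  rw [wedge_add_left, wedge_smul_left, wedge_smul_left, wedge_smul_right, wedge_smul_right,
    smul_smul, smul_smul]

/-- The first triple of vectors kills `dw̄ ∧ dz ∧ dw`, the second kills `dz̄ ∧ dz ∧ dw`. -/
theorem eq_of_smul_wedge_add {a b c : ℂ}
    (h : a • wedge dzbar dzdw = b • wedge dzbar dzdw + c • wedge dwbar dzdw) :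
    a = b ∧ c = 0 := by
  have h1 := DFunLike.congr_fun h ![(1, 0), (Complex.I, 0), (0, 1)]
  have h2 := DFunLike.congr_fun h ![(1, 0), (0, 1), (0, Complex.I)]
  simp [wedge_apply_three, dzdw_apply, dzbar_apply, dwbar_apply] at h1 h2
  exact ⟨h1, h2⟩

/-- The components of the equation `∂̄f = g` along `dz̄` and `dw̄`. -/
theorem IsWeakDbar.components {β : ℝ} {f : Form β 2}
    (hb : ∀ x ∈ cover β, HasBidegree 2 0 (f.toFun x))
    (hw : IsWeakDbar (cover β) f.toFun (gForm β).toFun) {χ : ℂ × ℂ → ℂ}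
    (h1 : ContDiff ℝ ∞ χ) (h2 : HasCompactSupport χ) (h3 : tsupport χ ⊆ cover β) :
    (∫ x in cover β, χ x * ((((1 + ‖x.1‖ ^ 2) ^ 2)⁻¹ : ℝ) * x.2⁻¹))
        = - ∫ x in cover β, dbarFun χ x (1, 0) * coeff (f.toFun x) ∧
      ∫ x in cover β, dbarFun χ x (0, 1) * coeff (f.toFun x) = 0 := by
  obtain ⟨hf, -, hint⟩ := hw
  have hU := (isOpen_cover β).measurableSet
  have hi : ∀ v, IntegrableOn (fun x => dbarFun χ x v * coeff (f.toFun x)) (cover β) := fun v =>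
    integrableOn_mul_of_support_subset (locallyIntegrableOn_coeff hf) (continuous_dbarFun h1 v)
      h2 h3 (support_dbarFun_subset χ v)
  have e := hint χ h1 h2 h3
  have e1 : ∫ x in cover β, χ x • (gForm β).toFun x
      = (∫ x in cover β, χ x * ((((1 + ‖x.1‖ ^ 2) ^ 2)⁻¹ : ℝ) * x.2⁻¹)) •
        wedge dzbar dzdw := by
    refine Eq.trans ?_ (integral_smul_const (𝕜 := ℂ) (E := Cov 3) _ _)
    refine integral_congr_ae (Filter.Eventually.of_forall fun x => ?_)
    simp only [gForm_toFun, smul_smul]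
  have e2 : ∫ x in cover β, wedge (dbarFun χ x) (f.toFun x)
      = (∫ x in cover β, dbarFun χ x (1, 0) * coeff (f.toFun x)) • wedge dzbar dzdw
        + (∫ x in cover β, dbarFun χ x (0, 1) * coeff (f.toFun x)) • wedge dwbar dzdw := by
    refine Eq.trans ?_ ((integral_add ((hi _).smul_const _) ((hi _).smul_const _)).trans
      (congrArg₂ (· + ·) (integral_smul_const (𝕜 := ℂ) (E := Cov 3) _ _)
        (integral_smul_const (𝕜 := ℂ) (E := Cov 3) _ _)))
    exact setIntegral_congr_fun hU fun x hx => wedge_dbarFun_eq (hb x hx) χ x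
  rw [e1, e2] at e
  obtain ⟨r1, r2⟩ := eq_of_smul_wedge_add (e.trans ((neg_add _ _).trans
    (congrArg₂ (· + ·) (neg_smul _ (wedge dzbar dzdw)).symm
      (neg_smul _ (wedge dwbar dzdw)).symm)))
  exact ⟨r1, neg_eq_zero.mp r2⟩

theorem dbarFun_antilinear_mul {a : (ℂ × ℂ) →L[ℝ] ℂ}
    (ha : ∀ v, a (Complex.I • v) = -Complex.I * a v) {ψ : ℂ × ℂ → ℂ} {x : ℂ × ℂ}
    (hψ : DifferentiableAt ℝ ψ x) (v : ℂ × ℂ) :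
    dbarFun (fun y => a y * ψ y) x v = a x * dbarFun ψ x v + ψ x * a v := by
  have h : HasFDerivAt (fun y => a y * ψ y) (a x • fderiv ℝ ψ x + ψ x • a) x :=
    a.hasFDerivAt.mul hψ.hasFDerivAt
  simp only [dbarFun_eq, h.fderiv, add_apply, smul_apply, smul_eq_mul, ha]
  linear_combination (-1 / 2 : ℂ) * ψ x * a v * Complex.I_sq

theorem dbarFun_smul (ψ : ℂ × ℂ → ℂ) (x : ℂ × ℂ) :
    dbarFun ψ x (x.1, -x.2)
      = starRingEnd ℂ x.1 * dbarFun ψ x (1, 0) - starRingEnd ℂ x.2 * dbarFun ψ x (0, 1) := by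
  conv_lhs => rw [eq_dzbar_add_dwbar (dbarFun_I_smul ψ x)]
  simp [dzbar_apply, dwbar_apply]
  ring

/-- The equation `∂̄f = g` tested against derivatives along the antiholomorphic vector field
`z̄ ∂_z̄ - w̄ ∂_w̄`, which is tangent to the level sets of `z w`. -/
theorem IsWeakDbar.radial {β : ℝ} {f : Form β 2}
    (hb : ∀ x ∈ cover β, HasBidegree 2 0 (f.toFun x))
    (hw : IsWeakDbar (cover β) f.toFun (gForm β).toFun) {ψ : ℂ × ℂ → ℂ}
    (h1 : ContDiff ℝ ∞ ψ) (h2 : HasCompactSupport ψ) (h3 : tsupport ψ ⊆ cover β) :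
    (∫ x in cover β, starRingEnd ℂ x.1 * ψ x * ((((1 + ‖x.1‖ ^ 2) ^ 2)⁻¹ : ℝ) * x.2⁻¹))
        = - ∫ x in cover β, dbarFun ψ x (x.1, -x.2) * coeff (f.toFun x) := by
  have ha1 : ∀ v, dzbar (Complex.I • v) = -Complex.I * dzbar v := fun v => by simp [dzbar_apply]
  have ha2 : ∀ v, dwbar (Complex.I • v) = -Complex.I * dwbar v := fun v => by simp [dwbar_apply]
  have hts : ∀ a : (ℂ × ℂ) →L[ℝ] ℂ, tsupport (fun y => a y * ψ y) ⊆ tsupport ψ := fun a =>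
    closure_mono (Function.support_mul_subset_right _ _)
  have hcd : ∀ a : (ℂ × ℂ) →L[ℝ] ℂ, ContDiff ℝ ∞ (fun y => a y * ψ y) := fun a =>
    a.contDiff.mul h1
  have hcs : ∀ a : (ℂ × ℂ) →L[ℝ] ℂ, HasCompactSupport (fun y => a y * ψ y) := fun a =>
    h2.mul_left
  have hi : ∀ (a : (ℂ × ℂ) →L[ℝ] ℂ) (v : ℂ × ℂ),
      IntegrableOn (fun x => dbarFun (fun y => a y * ψ y) x v * coeff (f.toFun x)) (cover β) :=
    fun a v => integrableOn_mul_of_support_subset (locallyIntegrableOn_coeff hw.1)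
      (continuous_dbarFun (hcd a) v) (hcs a) ((hts a).trans h3) (support_dbarFun_subset _ v)
  -- Test the two components with `z̄ψ` and `w̄ψ`. The zeroth-order terms `ψ` from the Leibniz rule
  -- cancel in the difference, since the field is divergence free.
  obtain ⟨p, -⟩ := hw.components hb (hcd dzbar) (hcs dzbar) ((hts dzbar).trans h3)
  obtain ⟨-, q⟩ := hw.components hb (hcd dwbar) (hcs dwbar) ((hts dwbar).trans h3)
  have e : ∀ x, dbarFun ψ x (x.1, -x.2) * coeff (f.toFun x)
      = dbarFun (fun y => dzbar y * ψ y) x (1, 0) * coeff (f.toFun x)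
        - dbarFun (fun y => dwbar y * ψ y) x (0, 1) * coeff (f.toFun x) := by
    intro x
    have hd : DifferentiableAt ℝ ψ x := (h1.differentiable (by simp)) x
    rw [dbarFun_antilinear_mul ha1 hd, dbarFun_antilinear_mul ha2 hd, dbarFun_smul]
    simp only [dzbar_apply, dwbar_apply, map_one]
    ring
  simp only [e]
  rw [integral_sub (hi _ _) (hi _ _), q, sub_zero]
  exact p

/-! ### Test functions of the form `σ(|z|²) B(z w)` -/

/-- The field `z̄ ∂_z̄ - w̄ ∂_w̄` kills both `zw` and its conjugate, hence `B(zw)` even for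
non-holomorphic `B`. It maps `|z|²` to itself, so it acts on `σ` as `t d/dt`. -/
theorem dbarFun_radial_mul_comp_mul {σ : ℝ → ℝ} {B : ℂ → ℂ} (hσ : Differentiable ℝ σ)
    (hB : Differentiable ℝ B) (x : ℂ × ℂ) :
    dbarFun (fun y => (σ (‖y.1‖ ^ 2) : ℂ) * B (y.1 * y.2)) x (x.1, -x.2)
      = (deriv σ (‖x.1‖ ^ 2) * ‖x.1‖ ^ 2 : ℝ) * B (x.1 * x.2) := by
  have hn : HasFDerivAt (fun y : ℂ × ℂ => ‖y.1‖ ^ 2)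
      (((2 : ℕ) • innerSL ℝ x.1).comp (ContinuousLinearMap.fst ℝ ℂ ℂ)) x :=
    ((hasStrictFDerivAt_norm_sq x.1).hasFDerivAt).comp x hasFDerivAt_fst
  have hs := (hσ (‖x.1‖ ^ 2)).hasDerivAt.comp_hasFDerivAt x hn
  have hs' := Complex.ofRealCLM.hasFDerivAt.comp x hs
  have hm : HasFDerivAt (fun y : ℂ × ℂ => y.1 * y.2)
      (x.1 • ContinuousLinearMap.snd ℝ ℂ ℂ + x.2 • ContinuousLinearMap.fst ℝ ℂ ℂ) x :=
    hasFDerivAt_fst.mul hasFDerivAt_snd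
  have hc := (hB (x.1 * x.2)).hasFDerivAt.comp x hm
  have h := hs'.mul hc
  have h' : fderiv ℝ (fun y : ℂ × ℂ => (σ (‖y.1‖ ^ 2) : ℂ) * B (y.1 * y.2)) x = _ := h.fderiv
  have hz : inner ℝ x.1 (Complex.I * x.1) = (0 : ℝ) := by
    rw [Complex.inner]
    simp
    ring
  rw [dbarFun_eq, h']
  simp [hz, mul_comm x.2 x.1, mul_left_comm x.2 Complex.I x.1]
  ring_nf

/-- The lower bound on `|z|` turns the bound on `zw` into a bound on `w`. This makes the test
functions compactly supported. -/
theorem isCompact_radial_preimage {m M : ℝ} (hm : 0 < m) {D : Set ℂ} (hD : IsCompact D) :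
    IsCompact {x : ℂ × ℂ | ‖x.1‖ ^ 2 ∈ Set.Icc m M ∧ x.1 * x.2 ∈ D} := by
  obtain ⟨R, hR⟩ := hD.isBounded.exists_norm_le
  refine Metric.isCompact_of_isClosed_isBounded ?_ ?_
  · exact (isClosed_Icc.preimage (by fun_prop : Continuous fun x : ℂ × ℂ => ‖x.1‖ ^ 2)).inter
      (hD.isClosed.preimage (by fun_prop : Continuous fun x : ℂ × ℂ => x.1 * x.2))
  · refine isBounded_iff_forall_norm_le.mpr ⟨max (Real.sqrt M) (R / Real.sqrt m), ?_⟩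
    rintro ⟨z, w⟩ ⟨⟨h1, h2⟩, h3⟩
    have hs : 0 < Real.sqrt m := Real.sqrt_pos.mpr hm
    have hz1 : Real.sqrt m ≤ ‖z‖ := Real.sqrt_le_iff.mpr ⟨norm_nonneg _, h1⟩
    have hz2 : ‖z‖ ≤ Real.sqrt M := Real.le_sqrt_of_sq_le h2
    have hw : ‖w‖ ≤ R / Real.sqrt m := by
      rw [le_div_iff₀ hs]
      have := hR _ h3
      rw [norm_mul] at this
      nlinarith [norm_nonneg w]
    exact max_le_max hz2 hw

/-- The equation `∂̄f = g` tested against a function `σ(|z|²) z w b(z w)`. -/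
theorem IsWeakDbar.radial_bump {β : ℝ} {f : Form β 2}
    (hb : ∀ x ∈ cover β, HasBidegree 2 0 (f.toFun x))
    (hw : IsWeakDbar (cover β) f.toFun (gForm β).toFun) {σ : ℝ → ℝ} {m M : ℝ} (hm : 0 < m)
    (hσ : ContDiff ℝ ∞ σ) (hσs : Function.support σ ⊆ Set.Icc m M) {b : ℂ → ℝ}
    (hbs : ContDiff ℝ ∞ b) (hbc : HasCompactSupport b) (hbt : ∀ ξ ∈ tsupport b, 0 < ξ.re) :
    ((∫ x in cover β, σ (‖x.1‖ ^ 2) * ‖x.1‖ ^ 2 * b (x.1 * x.2) * ((1 + ‖x.1‖ ^ 2) ^ 2)⁻¹ : ℝ) : ℂ)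
      = - ∫ x in cover β, (deriv σ (‖x.1‖ ^ 2) * ‖x.1‖ ^ 2 : ℝ) *
          (x.1 * x.2 * b (x.1 * x.2)) * coeff (f.toFun x) := by
  -- The extra factor `ξ = zw` turns `z̄ / w` on the side of `g` into `|z|²`, so that the integrand
  -- becomes real.
  set B : ℂ → ℂ := fun ξ => ξ * b ξ with hB
  have hBd : ContDiff ℝ ∞ B := contDiff_id.mul (Complex.ofRealCLM.contDiff.comp hbs)
  set ψ : ℂ × ℂ → ℂ := fun y => (σ (‖y.1‖ ^ 2) : ℂ) * B (y.1 * y.2) with hψ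
  have hψd : ContDiff ℝ ∞ ψ := by
    refine ContDiff.mul ?_ (hBd.comp (contDiff_fst.mul contDiff_snd))
    exact Complex.ofRealCLM.contDiff.comp (hσ.comp ((contDiff_norm_sq ℝ).comp contDiff_fst))
  set K : Set (ℂ × ℂ) := {x | ‖x.1‖ ^ 2 ∈ Set.Icc m M ∧ x.1 * x.2 ∈ tsupport b}
  have hK : IsCompact K := isCompact_radial_preimage hm hbc
  have hsupp : Function.support ψ ⊆ K := by
    intro x hx
    obtain ⟨hx1, hx2⟩ := mul_ne_zero_iff.mp hx
    refine ⟨hσs (Complex.ofReal_ne_zero.mp hx1), subset_tsupport b ?_⟩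
    exact Complex.ofReal_ne_zero.mp (mul_ne_zero_iff.mp hx2).2
  have hts : tsupport ψ ⊆ K := closure_minimal hsupp hK.isClosed
  have hKU : K ⊆ cover β := by
    rw [cover_eq]
    exact fun x hx => hbt _ hx.2
  have e := hw.radial hb hψd (HasCompactSupport.of_support_subset_isCompact hK hsupp)
    (hts.trans hKU)
  simp only [hψ, dbarFun_radial_mul_comp_mul (hσ.differentiable (by simp))
    (hBd.differentiable (by simp))] at e
  rw [← e, ← integral_complex_ofReal]
  refine setIntegral_congr_fun (isOpen_cover β).measurableSet fun x hx => ?_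
  have hx0 := snd_ne_zero_of_mem_cover hx
  simp only [hB]
  push_cast
  rw [← Complex.conj_mul']
  field_simp

/-! ### Scaling, and the `L²` estimate on shells -/

theorem lintegral_comp_prod_smul {a b : ℝ} (ha : a ≠ 0) (hb : b ≠ 0) (F : ℂ × ℂ → ENNReal) :
    ∫⁻ x : ℂ × ℂ, F (a • x.1, b • x.2) = ENNReal.ofReal ((a ^ 2)⁻¹ * (b ^ 2)⁻¹) * ∫⁻ x, F x := by
  let e : ℂ × ℂ ≃ᵐ ℂ × ℂ :=
    MeasurableEquiv.prodCongr (MeasurableEquiv.smul₀ a ha) (MeasurableEquiv.smul₀ b hb)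
  have hmap : Measure.map e volume
      = ENNReal.ofReal ((a ^ 2)⁻¹ * (b ^ 2)⁻¹) • (volume : Measure (ℂ × ℂ)) := by
    have h := Measure.map_prod_map (volume : Measure ℂ) (volume : Measure ℂ)
      (measurable_const_smul a) (measurable_const_smul b)
    rw [Measure.map_addHaar_smul _ ha, Measure.map_addHaar_smul _ hb,
      Complex.finrank_real_complex, Measure.prod_smul_left, Measure.prod_smul_right, smul_smul,
      ← ENNReal.ofReal_mul (abs_nonneg _), ← abs_mul,
      abs_of_nonneg (by positivity : 0 ≤ (a ^ 2)⁻¹ * (b ^ 2)⁻¹)] at h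
    exact h.symm
  have h := lintegral_map_equiv F e (μ := volume)
  rw [hmap, lintegral_smul_measure] at h
  exact h.symm

theorem smul_mem_cover_iff {β a b : ℝ} (h : 0 < a * b) (x : ℂ × ℂ) :
    (a • x.1, b • x.2) ∈ cover β ↔ x ∈ cover β := by
  have e : ((a • x.1) * (b • x.2)).re = (a * b) * (x.1 * x.2).re := by
    rw [smul_mul_smul_comm, Complex.smul_re, smul_eq_mul]
  simp only [cover_eq, Set.mem_ofPred_eq, e, mul_pos_iff_of_pos_left h]

/-- The part of the fundamental domain over the shell `r ≤ |z| ≤ r s`. -/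
def shell (β s r : ℝ) : Set (ℂ × ℂ) := {x | x ∈ fundDom β ∧ r ≤ ‖x.1‖ ∧ ‖x.1‖ ≤ r * s}

theorem measurableSet_shell (β s r : ℝ) : MeasurableSet (shell β s r) := by
  have h1 : MeasurableSet {p : ℂ × ℂ | r ≤ ‖p.1‖} :=
    measurableSet_le measurable_const measurable_fst.norm
  have h2 : MeasurableSet {p : ℂ × ℂ | ‖p.1‖ ≤ r * s} :=
    measurableSet_le measurable_fst.norm measurable_const
  exact (measurableSet_fundDom β).inter (h1.inter h2)

theorem volume_shell_lt_top (β s r : ℝ) : volume (shell β s r) < ⊤ := by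
  refine (measure_mono ?_).trans_lt (measure_closedBall_lt_top (μ := volume)
    (x := (0 : ℂ × ℂ)) (r := max (r * s) (Real.exp (2 * Real.pi * β))))
  intro x hx
  rw [mem_closedBall_zero_iff]
  exact max_le_max hx.2.2 hx.1.2.2.le

/-- Since `s < L`, the shells are disjoint, so their integrals form a summable family. Indexing by ℤ
with `cofinite` covers both ends `z → 0` and `z → ∞`. -/
theorem tendsto_lintegral_shell {β s L : ℝ} (hs : 1 < s) (hsL : s < L) {H : ℂ × ℂ → ENNReal}
    (hH : ∫⁻ x in fundDom β, H x < ⊤) :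
    Tendsto (fun k : ℤ => ∫⁻ x in shell β s (L ^ k), H x) cofinite (𝓝 0) := by
  have hL : 1 < L := hs.trans hsL
  apply ENNReal.tendsto_cofinite_zero_of_tsum_ne_top
  have hlt : ∀ i j : ℤ, i < j → Disjoint (shell β s (L ^ i)) (shell β s (L ^ j)) := by
    intro i j hij
    rw [Set.disjoint_left]
    rintro x ⟨-, -, h1⟩ ⟨-, h2, -⟩
    have h3 : L ^ (i + 1) ≤ L ^ j := zpow_le_zpow_right₀ hL.le hij
    rw [zpow_add_one₀ (by positivity)] at h3
    have h4 : L ^ i * s < L ^ i * L := mul_lt_mul_of_pos_left hsL (zpow_pos (by positivity) i)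
    linarith
  have hd : Pairwise (Function.onFun Disjoint fun k : ℤ => shell β s (L ^ k)) := by
    intro i j hij
    rcases lt_or_gt_of_ne hij with h | h
    · exact hlt i j h
    · exact (hlt j i h).symm
  rw [← lintegral_iUnion (fun k => measurableSet_shell β s (L ^ k)) hd]
  exact ((lintegral_mono_set (Set.iUnion_subset fun k x hx => hx.1)).trans_lt hH).ne

/-- Stands in for Cauchy–Schwarz: it bounds an L¹ integral by a small multiple of the volume plus a
multiple of the L² integral. -/
theorem le_add_sq_div {δ x : ℝ} (hδ : 0 < δ) : x ≤ δ + x ^ 2 / δ := by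
  have : δ + x ^ 2 / δ - x = ((x - δ / 2) ^ 2 + 3 / 4 * δ ^ 2) / δ := by
    field_simp
    ring
  have h2 : 0 ≤ ((x - δ / 2) ^ 2 + 3 / 4 * δ ^ 2) / δ := by positivity
  linarith

theorem lintegral_shell_scaled {β s r : ℝ} (hr : 0 < r) (h : ℂ × ℂ → ℂ) :
    ∫⁻ x in shell β s 1, ENNReal.ofReal ((r * ‖h (r • x.1, x.2)‖) ^ 2)
      = ∫⁻ x in shell β s r, ENNReal.ofReal (‖h x‖ ^ 2) := by
  have hsc := lintegral_comp_prod_smul hr.ne' one_ne_zero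
    ((shell β s r).indicator fun x => ENNReal.ofReal (‖h x‖ ^ 2))
  have hmem : ∀ x : ℂ × ℂ, (r • x.1, (1 : ℝ) • x.2) ∈ shell β s r ↔ x ∈ shell β s 1 := by
    intro x
    have hc := smul_mem_cover_iff (β := β) (by simpa using hr : 0 < r * 1) x
    simp only [one_smul] at hc
    simp only [shell, fundDom, Set.mem_ofPred_eq, hc, one_smul, norm_smul,
      Real.norm_of_nonneg hr.le, one_mul]
    rw [le_mul_iff_one_le_right hr, mul_le_mul_iff_right₀ hr]
  rw [lintegral_indicator (measurableSet_shell β s r)] at hsc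
  have e : ∫⁻ x in shell β s 1, ENNReal.ofReal ((r * ‖h (r • x.1, x.2)‖) ^ 2)
      = ∫⁻ x : ℂ × ℂ, ENNReal.ofReal (r ^ 2) *
        (shell β s r).indicator (fun x => ENNReal.ofReal (‖h x‖ ^ 2)) (r • x.1, (1 : ℝ) • x.2) := by
    rw [← lintegral_indicator (measurableSet_shell β s 1)]
    refine lintegral_congr fun x => ?_
    by_cases hx : x ∈ shell β s 1
    · rw [Set.indicator_of_mem hx, Set.indicator_of_mem ((hmem x).mpr hx), one_smul, mul_pow,
        ENNReal.ofReal_mul (by positivity)]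
    · rw [Set.indicator_of_notMem hx, Set.indicator_of_notMem (fun h' => hx ((hmem x).mp h')),
        mul_zero]
  rw [e, lintegral_const_mul' _ _ ENNReal.ofReal_ne_top, hsc, ← mul_assoc,
    ← ENNReal.ofReal_mul (by positivity)]
  have : r ^ 2 * ((r ^ 2)⁻¹ * ((1 : ℝ) ^ 2)⁻¹) = 1 := by field_simp
  rw [this, ENNReal.ofReal_one, one_mul]

/-- The integral of `R(|z|² / r²) Q(z w) h`, where `r` is a power of `e^{2πβ}`, is controlled by the
`L²` norm of `h` on the shell at radius `r`. -/
theorem lintegral_radial_le {β s r C : ℝ} (hr : 0 < r) (hs : 1 ≤ s) (hC : 0 ≤ C)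
    {h : ℂ × ℂ → ℂ}
    (hdeck : ∀ x ∈ cover β, ‖h (x.1, r⁻¹ • x.2)‖ = r * ‖h x‖)
    {R : ℝ → ℝ} {Q : ℂ → ℂ} (hR : ∀ t, R t ≠ 0 → 1 ≤ t ∧ t ≤ s ^ 2)
    (hQ : ∀ ξ, Q ξ ≠ 0 → s ≤ ‖ξ‖ ∧ ‖ξ‖ < Real.exp (2 * Real.pi * β))
    (hRQ : ∀ t ξ, ‖(R t : ℂ) * Q ξ‖ ≤ C) {δ : ℝ} (hδ : 0 < δ) :
    ∫⁻ x in cover β, ‖(R ((r ^ 2)⁻¹ * ‖x.1‖ ^ 2) : ℂ) * Q (x.1 * x.2) * h x‖ₑ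
      ≤ ENNReal.ofReal (C * δ) * volume (shell β s 1)
        + ENNReal.ofReal (C / δ) * ∫⁻ x in shell β s r, ENNReal.ofReal (‖h x‖ ^ 2) := by
  have hU := (isOpen_cover β).measurableSet
  have hri : 0 < r⁻¹ := inv_pos.mpr hr
  set F : ℂ × ℂ → ENNReal := (cover β).indicator fun x =>
    ‖(R ((r ^ 2)⁻¹ * ‖x.1‖ ^ 2) : ℂ) * Q (x.1 * x.2) * h x‖ₑ with hF
  -- The substitution `(z, w) ↦ (r z, r⁻¹ w)` has Jacobian 1, preserves `zw` and the covering, and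
  -- moves the shell at radius `r` to radius 1.
  have hsc := lintegral_comp_prod_smul hr.ne' hri.ne' F
  have h1 : (r ^ 2)⁻¹ * ((r⁻¹) ^ 2)⁻¹ = 1 := by field_simp
  rw [h1, ENNReal.ofReal_one, one_mul] at hsc
  rw [← lintegral_indicator hU, ← hF, ← hsc, ← lintegral_shell_scaled hr h, ← setLIntegral_const,
    ← lintegral_const_mul' _ _ ENNReal.ofReal_ne_top, ← lintegral_add_left measurable_const,
    ← lintegral_indicator (measurableSet_shell β s 1)]
  refine lintegral_mono fun x => ?_
  have hc := smul_mem_cover_iff (β := β) (a := r) (b := r⁻¹) (by positivity) x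
  by_cases hx : x ∈ cover β
  swap
  · simp only [hF]
    rw [Set.indicator_of_notMem (fun h' => hx (hc.mp h'))]
    exact zero_le
  simp only [hF]
  rw [Set.indicator_of_mem (hc.mpr hx)]
  have e1 : (r ^ 2)⁻¹ * ‖r • x.1‖ ^ 2 = ‖x.1‖ ^ 2 := by
    rw [norm_smul, Real.norm_of_nonneg hr.le]
    field_simp
  have e2 : (r • x.1) * (r⁻¹ • x.2) = x.1 * x.2 := by
    rw [smul_mul_smul_comm, mul_inv_cancel₀ hr.ne', one_smul]
  have e3 : ‖h (r • x.1, r⁻¹ • x.2)‖ = r * ‖h (r • x.1, x.2)‖ := by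
    refine hdeck (r • x.1, x.2) ?_
    have := (smul_mem_cover_iff (β := β) (a := r) (b := 1) (by simpa using hr) x).mpr hx
    simpa using this
  simp only [e1, e2]
  rcases eq_or_ne ((R (‖x.1‖ ^ 2) : ℂ) * Q (x.1 * x.2)) 0 with h0 | h0
  · rw [h0, zero_mul, enorm_zero]
    exact zero_le
  obtain ⟨h2, h3⟩ := mul_ne_zero_iff.mp h0
  obtain ⟨t1, t2⟩ := hR _ (Complex.ofReal_ne_zero.mp h2)
  obtain ⟨q1, q2⟩ := hQ _ h3
  have n1 : 1 ≤ ‖x.1‖ := by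
    by_contra hlt
    nlinarith [norm_nonneg x.1]
  have n2 : ‖x.1‖ ≤ s := abs_le_of_sq_le_sq' t2 (by linarith) |>.2
  rw [norm_mul] at q1 q2
  have hx2 := norm_nonneg x.2
  -- From `1 ≤ |z| ≤ s` and `s ≤ |zw| < e^{2πβ}` follows `1 ≤ |w| < e^{2πβ}`: the supports of `R`
  -- and `Q` are chosen so that one fundamental domain suffices.
  have hmem : x ∈ shell β s 1 := by
    refine ⟨⟨hx, ?_, ?_⟩, n1, by rwa [one_mul]⟩
    · by_contra hlt
      nlinarith
    · nlinarith
  rw [Set.indicator_of_mem hmem, ← ENNReal.ofReal_mul (by positivity),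
    ← ENNReal.ofReal_add (by positivity) (by positivity), ← ofReal_norm]
  refine ENNReal.ofReal_le_ofReal ?_
  rw [norm_mul, e3]
  calc _ ≤ C * (r * ‖h (r • x.1, x.2)‖) :=
        mul_le_mul_of_nonneg_right (hRQ _ _) (by positivity)
    _ ≤ C * (δ + (r * ‖h (r • x.1, x.2)‖) ^ 2 / δ) :=
        mul_le_mul_of_nonneg_left (le_add_sq_div hδ) hC
    _ = _ := by ring

/-! ### `g` is not in the range of `∂̄` -/

theorem exists_smooth_step {a : ℝ} (ha : 1 < a) : ∃ P : ℝ → ℝ, ContDiff ℝ ∞ P ∧ Monotone P ∧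
    (∀ t ≤ 1, P t = 0) ∧ ∀ t, a ≤ t → P t = 1 := by
  have h : 0 < a - 1 := sub_pos.mpr ha
  refine ⟨fun t => Real.smoothTransition ((t - 1) / (a - 1)), ?_, ?_, ?_, ?_⟩
  · exact Real.smoothTransition.contDiff.comp ((contDiff_id.sub contDiff_const).div_const _)
  · intro t u htu
    exact Real.smoothTransition.monotone (by gcongr)
  · intro t ht
    exact Real.smoothTransition.zero_of_nonpos
      (div_nonpos_of_nonpos_of_nonneg (by linarith) h.le)
  · intro t ht
    exact Real.smoothTransition.one_of_one_le ((one_le_div h).mpr (by linarith))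

theorem deriv_step_eq_zero {P : ℝ → ℝ} {a t : ℝ} (h0 : ∀ t ≤ 1, P t = 0)
    (h1 : ∀ t, a ≤ t → P t = 1) (ht : t < 1 ∨ a < t) : deriv P t = 0 := by
  rcases ht with ht | ht
  · have : P =ᶠ[𝓝 t] fun _ => 0 := by
      filter_upwards [Iio_mem_nhds ht] with u hu using h0 u hu.le
    rw [this.deriv_eq, deriv_const]
  · have : P =ᶠ[𝓝 t] fun _ => 1 := by
      filter_upwards [Ioi_mem_nhds ht] with u hu using h1 u hu.le
    rw [this.deriv_eq, deriv_const]

/-- The difference of two rescaled steps: a bump equal to `1` on most of `[q⁻¹, q]`. -/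
def plateau (P : ℝ → ℝ) (q t : ℝ) : ℝ := P (q * t) - P (q⁻¹ * t)

theorem contDiff_plateau {P : ℝ → ℝ} (hP : ContDiff ℝ ∞ P) (q : ℝ) :
    ContDiff ℝ ∞ (plateau P q) :=
  (hP.comp (contDiff_const.mul contDiff_id)).sub (hP.comp (contDiff_const.mul contDiff_id))

theorem deriv_plateau_mul {P : ℝ → ℝ} (hP : ContDiff ℝ ∞ P) (q t : ℝ) :
    deriv (plateau P q) t * t
      = q * t * deriv P (q * t) - q⁻¹ * t * deriv P (q⁻¹ * t) := by
  have hd : ∀ c, HasDerivAt (fun t => P (c * t)) (deriv P (c * t) * c) t := fun c => by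
    have h1 : HasDerivAt (fun t : ℝ => c * t) c t := by
      simpa using (hasDerivAt_id t).const_mul c
    exact ((hP.differentiable (by simp)) (c * t)).hasDerivAt.comp t h1
  have h : HasDerivAt (plateau P q) _ t := (hd q).sub (hd q⁻¹)
  rw [h.deriv]
  ring

theorem support_plateau_subset {P : ℝ → ℝ} {a q : ℝ} (h0 : ∀ t ≤ 1, P t = 0)
    (h1 : ∀ t, a ≤ t → P t = 1) (hq : 1 ≤ q) :
    Function.support (plateau P q) ⊆ Set.Icc q⁻¹ (q * a) := by
  have hq0 : 0 < q := by linarith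
  have hqi : q⁻¹ ≤ q := (inv_le_one_of_one_le₀ hq).trans hq
  intro t ht
  by_contra hnot
  apply ht
  unfold plateau
  rcases lt_or_ge t q⁻¹ with h | h
  · have e1 : q * t ≤ 1 := by
      have := mul_lt_mul_of_pos_left h hq0
      rw [mul_inv_cancel₀ hq0.ne'] at this
      exact this.le
    -- Negative `t` needs its own case, since there `q⁻¹ t ≥ q t`.
    have e2 : q⁻¹ * t ≤ 1 := by
      rcases le_total t 0 with ht0 | ht0
      · exact (mul_nonpos_of_nonneg_of_nonpos (by positivity) ht0).trans zero_le_one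
      · exact (mul_le_mul_of_nonneg_right hqi ht0).trans e1
    rw [h0 _ e1, h0 _ e2, sub_zero]
  · have h' : q * a < t := by
      by_contra hle
      exact hnot ⟨h, not_lt.mp hle⟩
    have ht0 : 0 ≤ t := (by positivity : (0 : ℝ) ≤ q⁻¹).trans h
    have e1 : a ≤ q⁻¹ * t := by
      rw [le_inv_mul_iff₀ hq0]
      exact h'.le
    have e2 : a ≤ q * t := e1.trans (mul_le_mul_of_nonneg_right hqi ht0)
    rw [h1 _ e1, h1 _ e2, sub_self]

theorem plateau_mono {P : ℝ → ℝ} (hP : Monotone P) {q q' t : ℝ} (hq : 0 < q) (hqq : q ≤ q')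
    (ht : 0 ≤ t) : plateau P q t ≤ plateau P q' t :=
  sub_le_sub (hP (mul_le_mul_of_nonneg_right hqq ht))
    (hP (mul_le_mul_of_nonneg_right (inv_anti₀ hq hqq) ht))

theorem plateau_nonneg {P : ℝ → ℝ} (hP : Monotone P) {q t : ℝ} (hq : 1 ≤ q) (ht : 0 ≤ t) :
    0 ≤ plateau P q t :=
  sub_nonneg.mpr (hP (mul_le_mul_of_nonneg_right ((inv_le_one_of_one_le₀ hq).trans hq) ht))

/-- The left-hand side of the tested equation stays away from zero. -/
theorem exists_pos_le_integral_plateau (β : ℝ) {P : ℝ → ℝ} {a q₀ : ℝ} (hP : ContDiff ℝ ∞ P)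
    (hPm : Monotone P) (h0 : ∀ t ≤ 1, P t = 0) (h1 : ∀ t, a ≤ t → P t = 1) (hq₀ : 1 ≤ q₀)
    (ha : a ≤ q₀) {b : ℂ → ℝ} (hb : Continuous b) (hbn : ∀ ξ, 0 ≤ b ξ)
    (hbc : HasCompactSupport b) (hbt : ∀ ξ ∈ tsupport b, 0 < ξ.re) {ξ₀ : ℂ} (hξ : b ξ₀ ≠ 0) :
    ∃ c > 0, ∀ q, q₀ ≤ q → c ≤ ∫ x in cover β, plateau P q (‖x.1‖ ^ 2) * ‖x.1‖ ^ 2 *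
      b (x.1 * x.2) * ((1 + ‖x.1‖ ^ 2) ^ 2)⁻¹ := by
  set G : ℝ → ℂ × ℂ → ℝ := fun q x => plateau P q (‖x.1‖ ^ 2) * ‖x.1‖ ^ 2 *
      b (x.1 * x.2) * ((1 + ‖x.1‖ ^ 2) ^ 2)⁻¹ with hG
  have hcont : ∀ q, Continuous (G q) := fun q => by
    have := (contDiff_plateau hP q).continuous
    have hne : ∀ x : ℂ × ℂ, (1 + ‖x.1‖ ^ 2) ^ 2 ≠ 0 := fun x => by positivity
    fun_prop (disch := assumption)
  have hcs : ∀ q, 1 ≤ q → HasCompactSupport (G q) := fun q hq => by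
    refine HasCompactSupport.of_support_subset_isCompact (isCompact_radial_preimage
      (inv_pos.mpr (zero_lt_one.trans_le hq)) hbc (M := q * a)) fun x hx => ?_
    have hx1 := left_ne_zero_of_mul hx
    exact ⟨support_plateau_subset h0 h1 hq (left_ne_zero_of_mul (left_ne_zero_of_mul hx1)),
      subset_tsupport b (right_ne_zero_of_mul hx1)⟩
  have hnn : ∀ q, 1 ≤ q → 0 ≤ G q := fun q hq x =>
    mul_nonneg (mul_nonneg (mul_nonneg (plateau_nonneg hPm hq (by positivity)) (by positivity))
      (hbn _)) (by positivity)
  have hfull : ∀ q, ∫ x in cover β, G q x = ∫ x, G q x := fun q => by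
    refine setIntegral_eq_integral_of_forall_compl_eq_zero fun x hx => ?_
    by_contra hne
    apply hx
    rw [cover_eq]
    exact hbt _ (subset_tsupport b (right_ne_zero_of_mul (left_ne_zero_of_mul hne)))
  -- The integrand is nonnegative and increases with `q`, so its integral at `q₀` is a uniform lower
  -- bound. It is positive because the integrand is positive at `(1, ξ₀)`.
  refine ⟨∫ x, G q₀ x, ?_, fun q hq => ?_⟩
  · refine Continuous.integral_pos_of_hasCompactSupport_nonneg_nonzero (x := (1, ξ₀))
      (hcont q₀) (hcs q₀ hq₀) (hnn q₀ hq₀) ?_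
    have e : plateau P q₀ 1 = 1 := by
      unfold plateau
      rw [mul_one, mul_one, h1 _ ha, h0 _ (inv_le_one_of_one_le₀ hq₀), sub_zero]
    simp [hG, e, hξ]
  · change _ ≤ ∫ x in cover β, G q x
    rw [hfull]
    have hq1 := hq₀.trans hq
    refine integral_mono ((hcont _).integrable_of_hasCompactSupport (hcs _ hq₀))
      ((hcont _).integrable_of_hasCompactSupport (hcs _ hq1)) fun x => ?_
    simp only [hG]
    have := plateau_mono hPm (zero_lt_one.trans_le hq₀) hq (by positivity : 0 ≤ ‖x.1‖ ^ 2)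
    have := hbn (x.1 * x.2)
    gcongr

/-- A bound that holds for all small parameters and a null sequence forces the bounded quantity
to vanish. -/
theorem eq_zero_of_le_mul_add {c V : ENNReal} {C : ℝ} (hV : V ≠ ⊤) {J : ℕ → ENNReal}
    (hJ : Tendsto J atTop (𝓝 0))
    (h : ∀ δ > 0, ∀ᶠ n in atTop,
      c ≤ ENNReal.ofReal (C * δ) * V + ENNReal.ofReal (C / δ) * J n) : c = 0 := by
  have h1 : ∀ δ > 0, c ≤ ENNReal.ofReal (C * δ) * V := by
    intro δ hδ
    have ht := (ENNReal.Tendsto.const_mul (a := ENNReal.ofReal (C / δ)) hJ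
      (Or.inr ENNReal.ofReal_ne_top)).const_add (ENNReal.ofReal (C * δ) * V)
    rw [mul_zero, add_zero] at ht
    exact ge_of_tendsto ht (h δ hδ)
  have h2 : Tendsto (fun δ : ℝ => ENNReal.ofReal (C * δ) * V) (𝓝[>] 0) (𝓝 0) := by
    have h3 : Tendsto (fun δ : ℝ => ENNReal.ofReal (C * δ)) (𝓝[>] 0) (𝓝 0) := by
      have h4 : Tendsto (fun δ : ℝ => C * δ) (𝓝[>] 0) (𝓝 0) := by
        have : Tendsto (fun δ : ℝ => C * δ) (𝓝 0) (𝓝 (C * 0)) :=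
          (continuous_const.mul continuous_id).tendsto 0
        rw [mul_zero] at this
        exact this.mono_left nhdsWithin_le_nhds
      simpa using ENNReal.tendsto_ofReal h4
    simpa using ENNReal.Tendsto.mul_const h3 (Or.inr hV)
  exact le_antisymm (ge_of_tendsto h2 (eventually_mem_nhdsWithin.mono h1)) zero_le

theorem gForm_notMem_dbarRange {β : ℝ} (hβ : 0 < β) : gForm β ∉ dbarRange β 2 0 := by
  rintro ⟨f, hfL, -, hw⟩
  have hf := hfL.1
  change Form β 2 at f
  set h : ℂ × ℂ → ℂ := fun x => coeff (f.toFun x) with hh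
  set L : ℝ := Real.exp (2 * Real.pi * β) with hL
  -- With `s = L^{1/4}` there is room for a disc around `s²` inside the annulus `s ≤ |ξ| < L`.
  set s : ℝ := Real.exp (Real.pi * β / 2) with hs
  have hs1 : 1 < s := Real.one_lt_exp_iff.mpr (by positivity)
  have hLs : L = s ^ 4 := by
    rw [hL, hs, ← Real.exp_nat_mul]
    congr 1
    push_cast
    ring
  have hsL : s < L := by
    rw [hLs]
    exact lt_self_pow₀ hs1 (by norm_num)
  have hL1 : 1 < L := hs1.trans hsL
  have hL0 : 0 < L := by linarith
  have hs2 : 1 < s ^ 2 := one_lt_pow₀ hs1 (by norm_num)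
  have hsL2 : s ^ 2 ≤ L ^ 2 := pow_le_pow_left₀ (by linarith) hsL.le 2
  have hsub : 0 < s ^ 2 - s := by nlinarith
  let b : ContDiffBump ((s ^ 2 : ℝ) : ℂ) :=
    ⟨(s ^ 2 - s) / 2, s ^ 2 - s, by linarith, by linarith⟩
  have hball : ∀ ξ ∈ tsupport b, s ≤ ‖ξ‖ ∧ ‖ξ‖ < L ∧ 0 < ξ.re := by
    intro ξ hξ
    rw [b.tsupport_eq, mem_closedBall_iff_norm] at hξ
    change _ ≤ s ^ 2 - s at hξ
    have hre : s ≤ ξ.re := by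
      have h1 := (abs_le.mp ((Complex.abs_re_le_norm _).trans hξ)).1
      rw [Complex.sub_re, Complex.ofReal_re] at h1
      linarith
    have hup : ‖ξ‖ ≤ s ^ 2 + (s ^ 2 - s) := by
      have h1 := norm_add_le ((s ^ 2 : ℝ) : ℂ) (ξ - ((s ^ 2 : ℝ) : ℂ))
      rw [add_sub_cancel, Complex.norm_real, Real.norm_of_nonneg (by positivity)] at h1
      linarith
    -- The upper bound is `2s² - s < 2s² - 1 ≤ s⁴ = L`.
    refine ⟨hre.trans (Complex.re_le_norm ξ), ?_, by linarith⟩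
    rw [hLs]
    nlinarith [sq_nonneg (s ^ 2 - 1)]
  have hbd : ContDiff ℝ ∞ (b : ℂ → ℝ) := b.contDiff
  obtain ⟨P, hP, hPm, hP0, hP1⟩ := exists_smooth_step hs2
  obtain ⟨c, hc0, hc⟩ := exists_pos_le_integral_plateau β hP hPm hP0 hP1
    (one_le_pow₀ hL1.le (n := 2)) hsL2 b.continuous (fun ξ => b.nonneg) b.hasCompactSupport
    (fun ξ hξ => (hball ξ hξ).2.2) (ξ₀ := ((s ^ 2 : ℝ) : ℂ))
    (b.pos_of_mem_ball (Metric.mem_ball_self b.rOut_pos)).ne'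
  -- `R` is `t d/dt` of the step. The derivative of the plateau produces `R(q t) - R(q⁻¹ t)`, one
  -- term for each end.
  set R : ℝ → ℝ := fun t => t * deriv P t with hR
  set Q : ℂ → ℂ := fun ξ => ξ * b ξ with hQ
  have hdP : Continuous (deriv P) := hP.continuous_deriv (by simp)
  have hRc : Continuous R := continuous_id.mul hdP
  have hQc : Continuous Q := continuous_id.mul (Complex.continuous_ofReal.comp b.continuous)
  have hRs : ∀ t, R t ≠ 0 → 1 ≤ t ∧ t ≤ s ^ 2 := by
    intro t ht
    by_contra hnot
    refine ht ?_
    simp only [hR]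
    rw [deriv_step_eq_zero hP0 hP1, mul_zero]
    by_contra! hcon
    exact hnot hcon
  have hQt : ∀ ξ, Q ξ ≠ 0 → ξ ∈ tsupport b := fun ξ hξ =>
    subset_tsupport _ (Complex.ofReal_ne_zero.mp (right_ne_zero_of_mul hξ))
  obtain ⟨C₁, hC₁⟩ := (HasCompactSupport.of_support_subset_isCompact (isCompact_Icc)
    (fun t ht => hRs t ht : Function.support R ⊆ Set.Icc 1 (s ^ 2))).exists_bound_of_continuous hRc
  obtain ⟨C₂, hC₂⟩ := (HasCompactSupport.of_support_subset_isCompact b.hasCompactSupport.isCompact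
    (fun ξ hξ => hQt ξ hξ : Function.support Q ⊆ tsupport b)).exists_bound_of_continuous hQc
  have hC₁0 : 0 ≤ C₁ := (norm_nonneg _).trans (hC₁ 0)
  have hC₂0 : 0 ≤ C₂ := (norm_nonneg _).trans (hC₂ 0)
  have hRQ : ∀ t ξ, ‖(R t : ℂ) * Q ξ‖ ≤ C₁ * C₂ := by
    intro t ξ
    rw [norm_mul, Complex.norm_real]
    exact mul_le_mul (hC₁ t) (hC₂ ξ) (norm_nonneg _) hC₁0
  set J : ℤ → ENNReal := fun k => ∫⁻ x in shell β s (L ^ k), ENNReal.ofReal (‖h x‖ ^ 2) with hJ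
  have hJ0 : Tendsto J cofinite (𝓝 0) :=
    tendsto_lintegral_shell hs1 hsL (lintegral_coeff_lt_top hfL)
  have hterm : ∀ (k : ℤ) (δ : ℝ), 0 < δ →
      ∫⁻ x in cover β, ‖(R (((L ^ k) ^ 2)⁻¹ * ‖x.1‖ ^ 2) : ℂ) * Q (x.1 * x.2) * h x‖ₑ
        ≤ ENNReal.ofReal (C₁ * C₂ * δ) * volume (shell β s 1)
          + ENNReal.ofReal (C₁ * C₂ / δ) * J k := by
    intro k δ hδ
    refine lintegral_radial_le (zpow_pos hL0 k) hs1.le (by positivity) ?_ hRs ?_ hRQ hδ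
    · rintro ⟨z, w⟩ hx
      -- The exponent `-k` makes the deck map `w ↦ L^{-k} w` compensate the dilation of `z` by
      -- `L^k`.
      have e := coeff_deck hf hx (-k)
      have e' : ((L : ℂ) ^ (-k)) * w = (L ^ k)⁻¹ • w := by
        rw [Complex.real_smul, zpow_neg]
        push_cast
        rfl
      rw [← hL, e'] at e
      simp only [hh]
      rw [e, norm_mul, norm_zpow, Complex.norm_real, Real.norm_of_nonneg hL0.le, zpow_neg,
        mul_inv_cancel_left₀ (zpow_pos hL0 k).ne']
    · exact fun ξ hξ => ⟨(hball ξ (hQt ξ hξ)).1, (hball ξ (hQt ξ hξ)).2.1⟩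
  have hhm : AEMeasurable h (volume.restrict (cover β)) :=
    (((ContinuousAlternatingMap.apply ℝ (ℂ × ℂ) ℂ
      ![((1 : ℂ), (0 : ℂ)), (0, 1)]).continuous.comp_aestronglyMeasurable hfL.2.1)).aemeasurable
  have hbound : ∀ n : ℕ, 1 ≤ n → ∀ δ > 0, ENNReal.ofReal c
      ≤ ENNReal.ofReal (C₁ * C₂ * δ) * (volume (shell β s 1) + volume (shell β s 1))
        + ENNReal.ofReal (C₁ * C₂ / δ) * (J (-n : ℤ) + J n) := by
    intro n hn δ hδ
    -- The square appears because the cutoffs depend on `|z|²`: the two edges of the plateau then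
    -- lie over the shells at radii `L^{-n}` and `L^n`.
    set q : ℝ := (L ^ n) ^ 2 with hq
    have hq1 : 1 ≤ q := one_le_pow₀ (one_le_pow₀ hL1.le)
    have hq2 : L ^ 2 ≤ q := pow_le_pow_left₀ hL0.le (le_self_pow₀ hL1.le (by omega)) 2
    have e := hw.radial_bump hf (inv_pos.mpr (zero_lt_one.trans_le hq1)) (contDiff_plateau hP q)
      (support_plateau_subset hP0 hP1 hq1) hbd b.hasCompactSupport
      (fun ξ hξ => (hball ξ hξ).2.2)
    have hk1 : ((L ^ (-n : ℤ)) ^ 2)⁻¹ = q := by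
      rw [zpow_neg, zpow_natCast, hq, inv_pow, inv_inv]
    have hk2 : ((L ^ (n : ℤ)) ^ 2)⁻¹ = q⁻¹ := by rw [zpow_natCast]
    have t1 := hterm (-n) δ hδ
    have t2 := hterm n δ hδ
    rw [hk1] at t1
    rw [hk2] at t2
    have hci := hc q hq2
    calc ENNReal.ofReal c ≤ ENNReal.ofReal (∫ x in cover β, plateau P q (‖x.1‖ ^ 2) *
          ‖x.1‖ ^ 2 * b (x.1 * x.2) * ((1 + ‖x.1‖ ^ 2) ^ 2)⁻¹) := ENNReal.ofReal_le_ofReal hci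
      _ = ‖((∫ x in cover β, plateau P q (‖x.1‖ ^ 2) *
          ‖x.1‖ ^ 2 * b (x.1 * x.2) * ((1 + ‖x.1‖ ^ 2) ^ 2)⁻¹ : ℝ) : ℂ)‖ₑ := by
          rw [← ofReal_norm, Complex.norm_real, Real.norm_of_nonneg (hc0.le.trans hci)]
      _ ≤ ∫⁻ x in cover β, ‖((deriv (plateau P q) (‖x.1‖ ^ 2) * ‖x.1‖ ^ 2 : ℝ) : ℂ) *
          (x.1 * x.2 * b (x.1 * x.2)) * coeff (f.toFun x)‖ₑ := by
          rw [e, enorm_neg]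
          exact enorm_integral_le_lintegral_enorm _
      _ ≤ ∫⁻ x in cover β, (‖(R (q * ‖x.1‖ ^ 2) : ℂ) * Q (x.1 * x.2) * h x‖ₑ
            + ‖(R (q⁻¹ * ‖x.1‖ ^ 2) : ℂ) * Q (x.1 * x.2) * h x‖ₑ) := by
          refine lintegral_mono fun x => ?_
          have e' : ((deriv (plateau P q) (‖x.1‖ ^ 2) * ‖x.1‖ ^ 2 : ℝ) : ℂ) *
              (x.1 * x.2 * b (x.1 * x.2)) * coeff (f.toFun x)
              = (R (q * ‖x.1‖ ^ 2) : ℂ) * Q (x.1 * x.2) * h x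
                - (R (q⁻¹ * ‖x.1‖ ^ 2) : ℂ) * Q (x.1 * x.2) * h x := by
            rw [deriv_plateau_mul hP]
            simp only [hR, hQ, hh]
            push_cast
            ring
          simp only [e']
          exact enorm_sub_le
      _ = (∫⁻ x in cover β, ‖(R (q * ‖x.1‖ ^ 2) : ℂ) * Q (x.1 * x.2) * h x‖ₑ)
            + ∫⁻ x in cover β, ‖(R (q⁻¹ * ‖x.1‖ ^ 2) : ℂ) * Q (x.1 * x.2) * h x‖ₑ := by
          refine lintegral_add_left' (AEMeasurable.enorm (AEMeasurable.mul ?_ hhm)) _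
          have : Continuous fun x : ℂ × ℂ => (R (q * ‖x.1‖ ^ 2) : ℂ) * Q (x.1 * x.2) := by
            fun_prop
          exact this.aemeasurable
      _ ≤ _ := (add_le_add t1 t2).trans_eq (by ring)
  have hJn : Tendsto (fun n : ℕ => J (-n : ℤ) + J n) atTop (𝓝 0) := by
    have i1 : Function.Injective fun n : ℕ => (-n : ℤ) := fun a b hab => by simpa using hab
    have i2 : Function.Injective fun n : ℕ => (n : ℤ) := Nat.cast_injective
    have := (hJ0.comp i1.tendsto_cofinite).add (hJ0.comp i2.tendsto_cofinite)
    rwa [Nat.cofinite_eq_atTop, add_zero] at this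
  have hV := (volume_shell_lt_top β s 1).ne
  -- For fixed `δ` let `n → ∞` to remove the shell integrals, then let `δ → 0`. This forces the
  -- positive constant `c` to vanish.
  have := eq_zero_of_le_mul_add (ENNReal.add_ne_top.mpr ⟨hV, hV⟩) hJn fun δ hδ =>
    (eventually_ge_atTop 1).mono fun n hn => hbound n hn δ hδ
  rw [ENNReal.ofReal_eq_zero] at this
  linarith

end Ohsawa

end

theorem proposition5p4 (β : ℝ) (hβ : 0 < β) :
    Ohsawa.gForm β ∈ Ohsawa.L2 β 2 1 ∧ Ohsawa.gForm β ∉ Ohsawa.dbarRange β 2 0 :=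
  ⟨Ohsawa.gForm_mem_L2 β, Ohsawa.gForm_notMem_dbarRange hβ⟩
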